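/- Let $d\ge 2$, $s\ge 1$, $m\in\mathbb R\setminus\{0\}$, $\eta=\mathrm{diag}(-1,1,\dots,1)$ the Minkowski metric on $\mathbb R^d$, $\mathcal P=\mathbb R[p_1,\dots,p_d]$, and for an $\mathbb R$-vector space $M$ let $ST_k(M)$ be the symmetric traceless tensors of rank $k$ in $d$ dimensions with components in $M$. Consider the massive spin-$s$ system $$(\square-m^2)\phi_{\mu_1\cdots\mu_s}=0,\qquad \partial^{\mu_s}\phi_{\mu_1\cdots\mu_s}=0,\qquad \phi\in ST_s.$$ Its symbol is $A:ST_s(\mathcal P)\oplus ST_{s-1}(\mathcal P)\to ST_s(\mathcal P)$, $A(J',J'')=(p^2-m^2)J'+(p\otimes J'')_{st}$ (the subscript $st$ denotes the symmetric traceless projection), the transpose, with respect to full contraction of indices, of $\phi\mapsto((p^2-m^2)\phi,\ p\cdot\phi)$. Let $A_1:ST_{s-1}(\mathcal P)\to ST_s(\mathcal P)\oplus ST_{s-1}(\mathcal P)$, $A_1Y=((p\otimes Y)_{st},\,-(p^2-m^2)Y)$, the transpose of $(j',j'')\mapsto p\cdot j'-(p^2-m^2)j''$. Then: 1. The $\mathcal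 P$-modules $ST_k(\mathcal P)$ occurring here ($k=s,s-1$) are free of finite rank, $0\to ST_{s-1}(\mathcal P)\xrightarrow{A_1}ST_s(\mathcal P)\oplus ST_{s-1}(\mathcal P)\xrightarrow{A}ST_s(\mathcal P)\to\mathrm{coker}\,A\to0$ is exact, and $A_1$ is unimodular (it has a left inverse). Hence the system is co-flat: its symbol has a one-step resolution by finite free modules whose leftmost map is unimodular. 2. Let braces denote the traceless part of the symmetrised tensor (the symmetrisation of $r$ gradients with a symmetric tensor of rank $k$ being the sum over all permutations divided by $r!\,k!$), and put $$\hat X^{(1)}\psi=\sum_{n=1}^{s}A_n\,\partial_{\{\mu_1}\cdots\partial_{\mu_n}(\partial^{n-1}\psi)_{\mu_{n+1}\cdots\mu_s\}},\qquad \hat X^{(2)}\psi=\sum_{n=1}^{s}B_n\,\partial_{\{\mu_1}\cdots\partial_{\mu_{n-1}}(\partial^{n-1}\psi)_{\mu_n\cdots\mu_{s-1}\}}$$ for $\psi\in ST_{s-1}$, where $\partial^{l}\psi$ is the $l$-fold divergence, with the scalar constants (not to be confused with the matrices $A$, $A_1$) given by $A_1=B_1=\frac1{m^2}$ and, for $1<n\le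 s$, $$A_n=\frac1{m^2}\Big(-\frac1{m^2}\Big)^{n-1}\prod_{r=1}^{n-1}\frac{2s+d-4-2r}{2s+d-4-r},\qquad B_n=\frac{2s+d-3-n}{2s+d-4}\,A_n .$$ The transpose $X:ST_s(\mathcal P)\oplus ST_{s-1}(\mathcal P)\to ST_{s-1}(\mathcal P)$ of the symbol of $(\hat X^{(1)},\hat X^{(2)})$ exists, is a left inverse, $XA_1=1$, and is Lorentz invariant: it commutes with the action $T(p)\mapsto L^{\otimes k}\,T(L^{-1}p)$ of every Lorentz transformation $L$. The square matrix $\binom{X}{A}$ has zero kernel and its cokernel is isomorphic to $\mathrm{coker}\,A$ as a $\mathcal P$-module. 3. For every open $\Omega\subseteq\mathbb R^d$ and every $\psi\in ST_{s-1}(C^\infty(\Omega))$ one has $\partial\cdot\hat X^{(1)}\psi-(\square-m^2)\hat X^{(2)}\psi=\psi$. The extended system, with the single auxiliary field $\psi$ and as many equations as fields, $$(\square-m^2)\phi+\hat X^{(1)}\psi=0,\qquad \partial\cdot\phi+\hat X^{(2)}\psi=0,$$ is equivalent to the original one: smooth symmetric traceless fields $\phi,\psi$ on $\Omega$, of ranks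 $s$ and $s-1$, satisfy it if and only if $\psi=0$, $(\square-m^2)\phi=0$ and $\partial\cdot\phi=0$. -/

import Mathlib

open scoped ContDiff

set_option linter.unusedSectionVars false

noncomputable section

namespace MassiveSpin

/-- The diagonal entries of the (mostly plus) Minkowski metric `diag(-1, 1, …, 1)` on `ℝ^d`.
The inverse metric has the same entries. -/
def eta {d : ℕ} (i : Fin d) : ℝ := if (i : ℕ) = 0 then -1 else 1

section Tensors

variable {d : ℕ} {R M : Type*} [CommRing R] [Algebra ℝ R] [AddCommGroup M] [Module R M]

/-! ### Fully symmetric tensors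

A fully symmetric tensor with components in `M` is encoded by the function which sends a
multiset `{μ₁, …, μₖ}` of indices to the component `T_{μ₁ ⋯ μₖ}` (all indices down).
Functions on multisets of arbitrary size are allowed at first; the rank is fixed by `symTensor`.
-/

/-- `T_{μ₁ ⋯ μₖ} ↦ T_{i μ₁ ⋯ μₖ}`. -/
def contract (i : Fin d) : (Multiset (Fin d) → M) →ₗ[R] (Multiset (Fin d) → M) where
  toFun T s := T (i ::ₘ s)
  map_add' _ _ := rfl
  map_smul' _ _ := rfl

/-- Symmetrised product with the `i`-th basis covector: `T ↦ ∑_a δ_{μₐ i} T_{μ₁ ⋯ (no μₐ) ⋯ μₖ}`,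
the sum being over all positions `a` of the multiset of indices. -/
def insertIdx (i : Fin d) : (Multiset (Fin d) → M) →ₗ[R] (Multiset (Fin d) → M) where
  toFun T s := s.count i • T (s.erase i)
  map_add' _ _ := by funext s; simp
  map_smul' _ _ := by funext s; exact smul_comm _ _ _

/-- The trace `T ↦ η^{μν} T_{μν ⋯}`. -/
def trace : (Multiset (Fin d) → M) →ₗ[R] (Multiset (Fin d) → M) :=
  ∑ i, algebraMap ℝ R (eta i) • (contract i ∘ₗ contract i)

/-- The symmetrised product `Θ ↦ η_{(μ₁μ₂} Θ_{μ₃⋯μₖ)}` with the metric, where the symmetrisation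
is the sum over all unordered pairs of positions (weight `1 / (2! (k-2)!)` for the sum over all
permutations). -/
def metricMul : (Multiset (Fin d) → M) →ₗ[R] (Multiset (Fin d) → M) :=
  algebraMap ℝ R (1 / 2) • ∑ i, algebraMap ℝ R (eta i) • (insertIdx i ∘ₗ insertIdx i)

/-- Symmetric tensors of rank `k`. -/
def symTensor (d : ℕ) (R M : Type*) [CommRing R] [AddCommGroup M] [Module R M] (k : ℕ) :
    Submodule R (Multiset (Fin d) → M) where
  carrier := {T | ∀ s, s.card ≠ k → T s = 0}
  add_mem' ha hb s hs := by simp [ha s hs, hb s hs]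
  zero_mem' _ _ := rfl
  smul_mem' c T hT s hs := by simp [hT s hs]

/-- Symmetric traceless tensors of rank `k`. -/
def stTensor (d : ℕ) (R M : Type*) [CommRing R] [Algebra ℝ R] [AddCommGroup M] [Module R M]
    (k : ℕ) : Submodule R (Multiset (Fin d) → M) :=
  symTensor d R M k ⊓ LinearMap.ker (trace (d := d) (R := R) (M := M))

/-! ### Traceless part -/

/-- The coefficients `(-1)^j / (j! ∏_{i<j} (2k+d-4-2i))` of the traceless projection in rank `k`. -/
def tracelessCoeff (d k j : ℕ) : ℝ :=
  (-1) ^ j / ((j.factorial : ℝ) * ∏ i ∈ Finset.range j, (2 * (k : ℝ) + d - 4 - 2 * i))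

/-- The traceless part of a symmetric tensor of rank `k`. It is traceless
(`tracelessPart_mem`) and differs from the tensor by a symmetrised product of the metric
with another tensor (`exists_sub_tracelessPart_eq`). -/
def tracelessPart (k : ℕ) : (Multiset (Fin d) → M) →ₗ[R] (Multiset (Fin d) → M) :=
  ∑ j ∈ Finset.range (k / 2 + 1),
    algebraMap ℝ R (tracelessCoeff d k j) • (metricMul ^ j * trace ^ j)

/-! ### Differential operators

The operators below are built from a family `D i`, `i : Fin d`, of endomorphisms of `M`: for the
partial derivatives of functions they are differential operators, for the multiplication by the
indeterminates of a polynomial ring they are the symbols of these operators. -/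

/-- `(D T)_{μ₂ ⋯ μₖ} = η^{μν} D_μ T_{ν μ₂ ⋯ μₖ}`. -/
def divergence (D : Fin d → Module.End R M) :
    (Multiset (Fin d) → M) →ₗ[R] (Multiset (Fin d) → M) :=
  ∑ i, algebraMap ℝ R (eta i) • ((D i).compLeft (Multiset (Fin d)) ∘ₗ contract i)

/-- `∑_a D_{μₐ} T_{μ₁ ⋯ (no μₐ) ⋯ μₖ}`. For commuting `D`'s, the `n`-th power of this operator is
`n!` times the symmetrised gradient `D_{(μ₁} ⋯ D_{μₙ} T_{μₙ₊₁ ⋯ μₙ₊ₖ)}`, the symmetrisation being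
the sum over all permutations divided by `n! k!`. -/
def gradient (D : Fin d → Module.End R M) :
    (Multiset (Fin d) → M) →ₗ[R] (Multiset (Fin d) → M) :=
  ∑ i, (D i).compLeft (Multiset (Fin d)) ∘ₗ insertIdx i

/-- The Klein–Gordon operator `η^{μν} D_μ D_ν - m²`. -/
def kleinGordon (D : Fin d → Module.End R M) (m : ℝ) : Module.End R M :=
  (∑ i, algebraMap ℝ R (eta i) • (D i * D i)) - algebraMap ℝ R (m ^ 2) • 1

end Tensors

section Lemmas

variable {d : ℕ} {R M : Type*} [CommRing R] [Algebra ℝ R] [AddCommGroup M] [Module R M]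

theorem mem_symTensor {k : ℕ} {T : Multiset (Fin d) → M} :
    T ∈ symTensor d R M k ↔ ∀ s, s.card ≠ k → T s = 0 := Iff.rfl

theorem mem_stTensor {k : ℕ} {T : Multiset (Fin d) → M} :
    T ∈ stTensor d R M k ↔ T ∈ symTensor d R M k ∧ trace (R := R) T = 0 := Iff.rfl

theorem eta_mul_self (i : Fin d) : eta i * eta i = 1 := by
  unfold eta; split_ifs <;> norm_num

theorem contract_insertIdx (i j : Fin d) :
    (contract i : Module.End R (Multiset (Fin d) → M)) * insertIdx j
      = insertIdx j * contract i + if i = j then 1 else 0 := by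
  ext T s
  by_cases h : i = j
  · subst h
    by_cases hs : i ∈ s
    · simp [contract, insertIdx, Multiset.cons_erase hs, add_smul]
    · simp [contract, insertIdx, Multiset.count_eq_zero_of_notMem hs]
  · simp [contract, insertIdx, h, Multiset.count_cons_of_ne (Ne.symm h),
      Multiset.erase_cons_tail s h]

theorem weyl_sq {A : Type*} [Ring A] {a c : A} (h : c * a = a * c + 1) :
    c * c * (a * a) = a * a * (c * c) + (4 * (a * c) + 2) := by
  have h1 : c * (a * a) = a * a * c + (a + a) := by
    rw [← mul_assoc, h, add_mul, mul_assoc, h, mul_add, one_mul, mul_one, mul_assoc, add_assoc]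
  have h2 : c * (a * a * c) = a * a * (c * c) + (a * c + a * c) := by
    rw [← mul_assoc, h1, add_mul, add_mul, mul_assoc (a * a)]
  rw [mul_assoc, h1, mul_add, mul_add, h2, h]
  have h4 : (4 : A) * (a * c) = a * c + a * c + (a * c + a * c) := by
    rw [← two_mul, ← two_mul, ← mul_assoc 2 2]; norm_num
  rw [h4, ← one_add_one_eq_two]
  abel

theorem contract_sq_insertIdx_sq (i j : Fin d) :
    (contract i * contract i : Module.End R (Multiset (Fin d) → M)) * (insertIdx j * insertIdx j)
      = insertIdx j * insertIdx j * (contract i * contract i)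
        + if i = j then 4 * (insertIdx i * contract i) + 2 else 0 := by
  have h := contract_insertIdx (R := R) (M := M) i j
  set c : Module.End R (Multiset (Fin d) → M) := contract i
  set a : Module.End R (Multiset (Fin d) → M) := insertIdx j
  by_cases hij : i = j
  · subst hij
    simp only [if_true] at h ⊢
    exact weyl_sq h
  · simp only [hij, if_false, add_zero] at h ⊢
    grind

theorem sum_insertIdx_contract {r : ℕ} {U : Multiset (Fin d) → M} (hU : U ∈ symTensor d R M r) :
    ∑ i, insertIdx (R := R) i (contract (R := R) i U) = r • U := by
  funext s
  have : ∀ i : Fin d, s.count i • U (i ::ₘ s.erase i) = s.count i • U s := by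
    intro i
    by_cases hs : i ∈ s
    · rw [Multiset.cons_erase hs]
    · simp [Multiset.count_eq_zero_of_notMem hs]
  simp only [Finset.sum_apply, insertIdx, contract, LinearMap.coe_mk, AddHom.coe_mk, this,
    Pi.smul_apply]
  rw [← Finset.sum_smul, Multiset.sum_count_eq_card (fun _ _ => Finset.mem_univ _)]
  by_cases hr : s.card = r
  · rw [hr]
  · simp [hU s hr]

theorem trace_metricMul {r : ℕ} {U : Multiset (Fin d) → M} (hU : U ∈ symTensor d R M r) :
    trace (R := R) (metricMul (R := R) U)
      = algebraMap ℝ R (d + 2 * r) • U + metricMul (R := R) (trace (R := R) U) := by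
  have key : ∀ i j : Fin d, contract (R := R) i (contract (R := R) i
      (insertIdx (R := R) j (insertIdx (R := R) j U)))
      = insertIdx (R := R) j (insertIdx (R := R) j (contract (R := R) i (contract (R := R) i U)))
        + if i = j then (4 : R) • insertIdx (R := R) i (contract (R := R) i U) + (2 : R) • U
          else 0 := by
    intro i j
    have := LinearMap.congr_fun (contract_sq_insertIdx_sq (R := R) (M := M) i j) U
    simp only [Module.End.mul_apply, LinearMap.add_apply] at this
    rw [this]
    split_ifs
    · simp only [LinearMap.add_apply, Module.End.mul_apply]
      congr 1
      congr 1
      · rw [← Nat.cast_ofNat, Module.End.natCast_apply, ← Nat.cast_smul_eq_nsmul R]; norm_num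
      · rw [← Nat.cast_ofNat, Module.End.natCast_apply, ← Nat.cast_smul_eq_nsmul R]; norm_num
    · rfl
  simp only [trace, metricMul, LinearMap.smul_apply, LinearMap.sum_apply, LinearMap.comp_apply,
    map_smul, map_sum, key, smul_add, Finset.sum_add_distrib, smul_ite, smul_zero,
    Finset.sum_ite_eq', Finset.mem_univ, if_true, Finset.smul_sum]
  have e : ∀ (x : Fin d), algebraMap ℝ R (eta x) * algebraMap ℝ R (eta x) = 1 := by
    intro x
    rw [← map_mul, eta_mul_self, map_one]
  have hh : algebraMap ℝ R (1 / 2) * 2 = 1 := by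
    rw [← map_ofNat (algebraMap ℝ R) 2, ← map_mul]; norm_num
  have hh4 : algebraMap ℝ R (1 / 2) * 4 = 2 := by
    linear_combination (2 : R) * hh
  have s1 : ∑ x : Fin d, algebraMap ℝ R (1 / 2) • algebraMap ℝ R (eta x) •
      algebraMap ℝ R (eta x) • (4 : R) • insertIdx (R := R) x (contract (R := R) x U)
      = (2 : R) • (r • U) := by
    rw [← sum_insertIdx_contract hU, Finset.smul_sum]
    refine Finset.sum_congr rfl fun x _ => ?_
    simp only [smul_smul]
    congr 1
    linear_combination 2 * e x + algebraMap ℝ R (eta x) ^ 2 * hh4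
  have s2 : ∑ x : Fin d, algebraMap ℝ R (1 / 2) • algebraMap ℝ R (eta x) •
      algebraMap ℝ R (eta x) • (2 : R) • U = d • U := by
    have hc : d • U = ∑ _x : Fin d, U := by simp
    rw [hc]
    refine Finset.sum_congr rfl fun x _ => ?_
    simp only [smul_smul]
    conv_rhs => rw [← one_smul R U]
    congr 1
    linear_combination e x + algebraMap ℝ R (eta x) ^ 2 * hh
  rw [s1, s2, Finset.sum_comm, add_comm]
  congr 1
  · rw [← Nat.cast_smul_eq_nsmul R, ← Nat.cast_smul_eq_nsmul R, smul_smul, ← add_smul]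
    congr 1
    rw [map_add, map_mul, map_natCast, map_natCast, map_ofNat, add_comm]
  · refine Finset.sum_congr rfl fun x _ => Finset.sum_congr rfl fun y _ => ?_
    simp only [smul_smul]
    congr 1
    ring

theorem contract_mem {k : ℕ} {T : Multiset (Fin d) → M} (hT : T ∈ symTensor d R M k) (i : Fin d) :
    contract (R := R) i T ∈ symTensor d R M (k - 1) := by
  intro s hs
  refine hT _ ?_
  rw [Multiset.card_cons]
  omega

theorem insertIdx_mem {k : ℕ} {T : Multiset (Fin d) → M} (hT : T ∈ symTensor d R M k) (i : Fin d) :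
    insertIdx (R := R) i T ∈ symTensor d R M (k + 1) := by
  intro s hs
  change s.count i • T (s.erase i) = 0
  by_cases h : i ∈ s
  · have := Multiset.card_erase_add_one h
    rw [hT _ (by omega), smul_zero]
  · rw [Multiset.count_eq_zero_of_notMem h, zero_smul]

theorem compLeft_mem {k : ℕ} {T : Multiset (Fin d) → M} (hT : T ∈ symTensor d R M k)
    (f : M →ₗ[R] M) : f.compLeft (Multiset (Fin d)) T ∈ symTensor d R M k := by
  intro s hs
  change f (T s) = 0
  rw [hT s hs, map_zero]

theorem trace_mem {k : ℕ} {T : Multiset (Fin d) → M} (hT : T ∈ symTensor d R M k) :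
    trace (R := R) T ∈ symTensor d R M (k - 2) := by
  simp only [trace, LinearMap.sum_apply, LinearMap.smul_apply, LinearMap.comp_apply]
  exact Submodule.sum_mem _ fun i _ => Submodule.smul_mem _ _ (contract_mem (contract_mem hT i) i)

theorem trace_eq_zero {k : ℕ} (hk : k < 2) {T : Multiset (Fin d) → M}
    (hT : T ∈ symTensor d R M k) : trace (R := R) T = 0 := by
  funext s
  simp only [trace, LinearMap.sum_apply, LinearMap.smul_apply, LinearMap.comp_apply,
    Finset.sum_apply, Pi.smul_apply, Pi.zero_apply]
  refine Finset.sum_eq_zero fun i _ => ?_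
  change _ • T (i ::ₘ i ::ₘ s) = 0
  rw [hT _ (by simp only [Multiset.card_cons]; omega), smul_zero]

theorem metricMul_mem {k : ℕ} {T : Multiset (Fin d) → M} (hT : T ∈ symTensor d R M k) :
    metricMul (R := R) T ∈ symTensor d R M (k + 2) := by
  simp only [metricMul, LinearMap.sum_apply, LinearMap.smul_apply, LinearMap.comp_apply]
  exact Submodule.smul_mem _ _ (Submodule.sum_mem _ fun i _ =>
    Submodule.smul_mem _ _ (insertIdx_mem (insertIdx_mem hT i) i))

theorem trace_pow_mem {k : ℕ} {T : Multiset (Fin d) → M} (hT : T ∈ symTensor d R M k) (j : ℕ) :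
    (trace (R := R) ^ j) T ∈ symTensor d R M (k - 2 * j) := by
  induction j with
  | zero => exact hT
  | succ j ih =>
    rw [pow_succ', Module.End.mul_apply]
    exact trace_mem ih

theorem metricMul_pow_mem {k : ℕ} {T : Multiset (Fin d) → M} (hT : T ∈ symTensor d R M k)
    (j : ℕ) : (metricMul (R := R) ^ j) T ∈ symTensor d R M (k + 2 * j) := by
  induction j with
  | zero => exact hT
  | succ j ih =>
    rw [pow_succ', Module.End.mul_apply]
    exact metricMul_mem ih

theorem trace_metricMul_pow {r : ℕ} {U : Multiset (Fin d) → M} (hU : U ∈ symTensor d R M r)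
    (j : ℕ) : trace (R := R) ((metricMul (R := R) ^ (j + 1)) U)
      = (metricMul (R := R) ^ (j + 1)) (trace (R := R) U)
        + algebraMap ℝ R ((j + 1) * (d + 2 * r + 2 * j)) • (metricMul (R := R) ^ j) U := by
  induction j with
  | zero =>
    simp only [zero_add, pow_one, pow_zero, Module.End.one_apply]
    rw [trace_metricMul hU, add_comm]
    norm_num
  | succ j ih =>
    have hm : ∀ (i : ℕ) (V : Multiset (Fin d) → M), (metricMul (R := R) ^ (i + 1)) V
        = metricMul (R := R) ((metricMul (R := R) ^ i) V) := by
      intro i V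
      rw [pow_succ', Module.End.mul_apply]
    rw [hm (j + 1) U, trace_metricMul (metricMul_pow_mem hU (j + 1)), ih,
      LinearMap.map_add, LinearMap.map_smul, ← hm j U, ← hm (j + 1) (trace U), add_left_comm,
      ← add_smul, ← map_add]
    congr 3
    push_cast
    ring

theorem tracelessPart_mem {k : ℕ} {T : Multiset (Fin d) → M} (hT : T ∈ symTensor d R M k) :
    tracelessPart (R := R) k T ∈ stTensor d R M k := by
  refine ⟨?_, ?_⟩
  · simp only [tracelessPart, LinearMap.sum_apply, LinearMap.smul_apply]
    refine Submodule.sum_mem _ fun j hj => Submodule.smul_mem _ _ ?_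
    have h := metricMul_pow_mem (trace_pow_mem hT j) j
    have hj' : k - 2 * j + 2 * j = k := by
      have := Finset.mem_range.1 hj
      omega
    rwa [hj'] at h
  · change trace (R := R) (tracelessPart (R := R) k T) = 0
    rcases Nat.eq_zero_or_pos d with rfl | hd
    · simp [trace]
    have key : ∀ N, 2 * N ≤ k → trace (R := R) ((∑ j ∈ Finset.range (N + 1),
        algebraMap ℝ R (tracelessCoeff d k j) • (metricMul ^ j * trace ^ j) :
          Module.End R (Multiset (Fin d) → M)) T)
        = algebraMap ℝ R (tracelessCoeff d k N) •
          (metricMul (R := R) ^ N) ((trace (R := R) ^ (N + 1)) T) := by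
      intro N
      induction N with
      | zero => intro _; simp [tracelessCoeff]
      | succ N ih =>
        intro hN
        rw [Finset.sum_range_succ, LinearMap.add_apply, map_add, ih (by omega),
          LinearMap.smul_apply, map_smul, Module.End.mul_apply,
          trace_metricMul_pow (trace_pow_mem hT (N + 1)), smul_add, smul_smul, ← map_mul,
          ← Module.End.mul_apply (trace (R := R)), ← pow_succ', add_left_comm, ← add_smul,
          ← map_add]
        have hc : tracelessCoeff d k N + tracelessCoeff d k (N + 1) * (((N : ℝ) + 1) *
            (d + 2 * ((k - 2 * (N + 1) : ℕ) : ℝ) + 2 * N)) = 0 := by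
          have hk : ((k - 2 * (N + 1) : ℕ) : ℝ) = k - 2 * (N + 1) := by
            rw [Nat.cast_sub hN]; push_cast; ring
          have h0 : (0 : ℝ) < 2 * (k : ℝ) + d - 4 - 2 * N := by
            have h1 : (1 : ℝ) ≤ d := by exact_mod_cast hd
            have h2 : 2 * ((N : ℝ) + 1) ≤ k := by exact_mod_cast hN
            have h3 : (0 : ℝ) ≤ N := Nat.cast_nonneg N
            linarith
          rw [hk, tracelessCoeff, tracelessCoeff, Finset.prod_range_succ, Nat.factorial_succ]
          set p : ℝ := ∏ i ∈ Finset.range N, (2 * (k : ℝ) + d - 4 - 2 * i)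
          have e : (d : ℝ) + 2 * (k - 2 * (N + 1)) + 2 * N = 2 * (k : ℝ) + d - 4 - 2 * N := by ring
          rw [e]
          push_cast
          rw [show ((N : ℝ) + 1) * (N.factorial : ℝ) * (p * (2 * (k : ℝ) + d - 4 - 2 * N))
            = ((N.factorial : ℝ) * p) * (((N : ℝ) + 1) * (2 * (k : ℝ) + d - 4 - 2 * N)) by ring,
            ← div_div ((-1 : ℝ) ^ (N + 1)), div_mul_cancel₀ _ (by positivity), pow_succ]
          ring
        rw [hc, map_zero, zero_smul, add_zero]
    rw [tracelessPart, key (k / 2) (by omega), pow_succ', Module.End.mul_apply,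
      trace_eq_zero (k := k - 2 * (k / 2)) (by omega) (trace_pow_mem hT _), map_zero, smul_zero]

theorem exists_sub_tracelessPart_eq {k : ℕ} {T : Multiset (Fin d) → M}
    (hT : T ∈ symTensor d R M k) :
    (k < 2 ∧ tracelessPart (R := R) k T = T) ∨ ∃ Θ ∈ symTensor d R M (k - 2),
      T - tracelessPart (R := R) k T = metricMul (R := R) Θ := by
  rcases lt_or_ge k 2 with hk | hk
  · left
    refine ⟨hk, ?_⟩
    have : k / 2 = 0 := by omega
    simp [tracelessPart, this, tracelessCoeff]
  · right
    refine ⟨-∑ j ∈ Finset.range (k / 2), algebraMap ℝ R (tracelessCoeff d k (j + 1)) •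
      (metricMul (R := R) ^ j) ((trace (R := R) ^ (j + 1)) T), ?_, ?_⟩
    · refine Submodule.neg_mem _ (Submodule.sum_mem _ fun j hj => Submodule.smul_mem _ _ ?_)
      have h := metricMul_pow_mem (trace_pow_mem hT (j + 1)) j
      have hj' : k - 2 * (j + 1) + 2 * j = k - 2 := by
        have := Finset.mem_range.1 hj
        omega
      rwa [hj'] at h
    · rw [tracelessPart, Finset.sum_range_succ', map_neg, map_sum]
      simp only [LinearMap.add_apply, LinearMap.sum_apply, LinearMap.smul_apply, map_smul,
        Module.End.mul_apply, pow_succ' (metricMul (R := R)), pow_zero, Module.End.one_apply]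
      simp [tracelessCoeff]

theorem divergence_mem {k : ℕ} {T : Multiset (Fin d) → M} (hT : T ∈ symTensor d R M k)
    (D : Fin d → Module.End R M) : divergence D T ∈ symTensor d R M (k - 1) := by
  simp only [divergence, LinearMap.sum_apply, LinearMap.smul_apply, LinearMap.comp_apply]
  exact Submodule.sum_mem _ fun i _ => Submodule.smul_mem _ _ (compLeft_mem (contract_mem hT i) _)

theorem gradient_mem {k : ℕ} {T : Multiset (Fin d) → M} (hT : T ∈ symTensor d R M k)
    (D : Fin d → Module.End R M) : gradient D T ∈ symTensor d R M (k + 1) := by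
  simp only [gradient, LinearMap.sum_apply, LinearMap.comp_apply]
  exact Submodule.sum_mem _ fun i _ => compLeft_mem (insertIdx_mem hT i) _

theorem trace_compLeft (f : M →ₗ[R] M) (T : Multiset (Fin d) → M) :
    trace (R := R) (f.compLeft (Multiset (Fin d)) T)
      = f.compLeft (Multiset (Fin d)) (trace (R := R) T) := by
  funext s
  simp [trace, contract]

theorem compLeft_mem_stTensor {k : ℕ} {T : Multiset (Fin d) → M} (hT : T ∈ stTensor d R M k)
    (f : M →ₗ[R] M) : f.compLeft (Multiset (Fin d)) T ∈ stTensor d R M k := by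
  refine mem_stTensor.2 ⟨compLeft_mem hT.1 f, ?_⟩
  rw [trace_compLeft, (mem_stTensor.1 hT).2, map_zero]

theorem divergence_mem_stTensor {k : ℕ} {T : Multiset (Fin d) → M} (hT : T ∈ stTensor d R M k)
    (D : Fin d → Module.End R M) : divergence D T ∈ stTensor d R M (k - 1) := by
  refine mem_stTensor.2 ⟨divergence_mem hT.1 D, ?_⟩
  have h0 := (mem_stTensor.1 hT).2
  have hc : ∀ i, trace (R := R) (contract (R := R) i T) = 0 := by
    intro i
    have h1 : trace (R := R) (contract (R := R) i T) = contract (R := R) i (trace (R := R) T) := by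
      funext s
      simp only [trace, contract, LinearMap.sum_apply, LinearMap.smul_apply, LinearMap.comp_apply,
        Finset.sum_apply, Pi.smul_apply, LinearMap.coe_mk, AddHom.coe_mk]
      refine Finset.sum_congr rfl fun j _ => ?_
      rw [Multiset.cons_swap i j, Multiset.cons_swap i j]
    rw [h1, h0, map_zero]
  simp only [divergence, LinearMap.sum_apply, LinearMap.smul_apply, LinearMap.comp_apply, map_sum,
    map_smul, trace_compLeft, hc, map_zero, smul_zero, Finset.sum_const_zero]

theorem divergence_pow_mem {k : ℕ} {T : Multiset (Fin d) → M} (hT : T ∈ symTensor d R M k)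
    (D : Fin d → Module.End R M) (l : ℕ) :
    (divergence D ^ l) T ∈ symTensor d R M (k - l) := by
  induction l with
  | zero => exact hT
  | succ l ih =>
    rw [pow_succ', Module.End.mul_apply]
    exact divergence_mem ih D

theorem gradient_pow_mem {k : ℕ} {T : Multiset (Fin d) → M} (hT : T ∈ symTensor d R M k)
    (D : Fin d → Module.End R M) (n : ℕ) :
    (gradient D ^ n) T ∈ symTensor d R M (k + n) := by
  induction n with
  | zero => exact hT
  | succ n ih =>
    rw [pow_succ', Module.End.mul_apply]
    exact gradient_mem ih D

end Lemmas

/-! ### The operators of the massive spin-`s` system -/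

section System

variable {d : ℕ} {R M : Type*} [CommRing R] [Algebra ℝ R] [AddCommGroup M] [Module R M]

/-- The Klein–Gordon operator, acting componentwise on symmetric traceless tensors. -/
def kleinGordonST (D : Fin d → Module.End R M) (m : ℝ) (k : ℕ) :
    stTensor d R M k →ₗ[R] stTensor d R M k :=
  ((kleinGordon D m).compLeft (Multiset (Fin d))).restrict
    fun _ hT => compLeft_mem_stTensor hT (kleinGordon D m)

/-- The divergence of symmetric traceless tensors. -/
def divergenceST (D : Fin d → Module.End R M) (k : ℕ) :
    stTensor d R M k →ₗ[R] stTensor d R M (k - 1) :=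
  (divergence D).restrict fun _ hT => divergence_mem_stTensor hT D

/-- `ψ ↦ D_{{μ₁} ⋯ D_{μₙ} (D^l ψ)_{μₙ₊₁ ⋯ μₜ}}`, from symmetric traceless tensors of rank `k` to
symmetric traceless tensors of rank `t = k - l + n`: take `l` divergences, then the symmetrised
`n`-fold gradient, then the traceless part. -/
def gradDiv (D : Fin d → Module.End R M) (k t n l : ℕ) (h : k - l + n = t) :
    stTensor d R M k →ₗ[R] stTensor d R M t :=
  LinearMap.codRestrict (stTensor d R M t)
    (algebraMap ℝ R (1 / n.factorial) • (tracelessPart t ∘ₗ (gradient D ^ n) ∘ₗ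
      (divergence D ^ l) ∘ₗ (stTensor d R M k).subtype))
    (fun T => Submodule.smul_mem _ _ (tracelessPart_mem
      (h ▸ gradient_pow_mem (divergence_pow_mem T.2.1 D l) D n)))

/-- The operator `φ ↦ ((□ - m²) φ, ∂ · φ)` of the massive spin-`s` system. -/
def waveOp (D : Fin d → Module.End R M) (m : ℝ) (s : ℕ) :
    stTensor d R M s →ₗ[R] stTensor d R M s × stTensor d R M (s - 1) :=
  (kleinGordonST D m s).prod (divergenceST D s)

/-- The compatibility operator `(j', j'') ↦ ∂ · j' - (□ - m²) j''`. -/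
def compatOp (D : Fin d → Module.End R M) (m : ℝ) (s : ℕ) :
    stTensor d R M s × stTensor d R M (s - 1) →ₗ[R] stTensor d R M (s - 1) :=
  (divergenceST D s).coprod (-kleinGordonST D m (s - 1))

/-- The coefficients `A_n`, `1 ≤ n ≤ s`. -/
def coeffA (d s : ℕ) (m : ℝ) (n : ℕ) : ℝ :=
  1 / m ^ 2 * (-1 / m ^ 2) ^ (n - 1) *
    ∏ r ∈ Finset.Icc 1 (n - 1), (2 * (s : ℝ) + d - 4 - 2 * r) / (2 * (s : ℝ) + d - 4 - r)

/-- The coefficients `B_n`, `1 ≤ n ≤ s`. -/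
def coeffB (d s : ℕ) (m : ℝ) (n : ℕ) : ℝ :=
  if n = 1 then 1 / m ^ 2
  else (2 * (s : ℝ) + d - 3 - n) / (2 * (s : ℝ) + d - 4) * coeffA d s m n

/-- The first block of `X̂`:
`ψ ↦ A_1 ∂_{{μ₁} ψ_{μ₂⋯μₛ}} + A_2 ∂_{{μ₁} ∂_{μ₂} (∂ψ)_{μ₃⋯μₛ}} + ⋯ + A_s ∂_{{μ₁} ⋯ ∂_{μₛ}} ∂^{s-1}ψ`
(the summation index is `n - 1`). -/
def auxOp₁ (D : Fin d → Module.End R M) (m : ℝ) (s : ℕ) :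
    stTensor d R M (s - 1) →ₗ[R] stTensor d R M s :=
  ∑ l : Fin s, algebraMap ℝ R (coeffA d s m (l + 1)) •
    gradDiv D (s - 1) s (l + 1) l (by have := l.2; omega)

/-- The second block of `X̂`:
`ψ ↦ B_1 ψ_{μ₁⋯μₛ₋₁} + B_2 ∂_{{μ₁} (∂ψ)_{μ₂⋯μₛ₋₁}} + ⋯ + B_s ∂_{{μ₁} ⋯ ∂_{μₛ₋₁}} ∂^{s-1}ψ`
(the summation index is `n - 1`). -/
def auxOp₂ (D : Fin d → Module.End R M) (m : ℝ) (s : ℕ) :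
    stTensor d R M (s - 1) →ₗ[R] stTensor d R M (s - 1) :=
  ∑ l : Fin s, algebraMap ℝ R (coeffB d s m (l + 1)) •
    gradDiv D (s - 1) (s - 1) l l (by have := l.2; omega)

/-- The operator `X̂`, by which the auxiliary field enters the extended system. -/
def auxOp (D : Fin d → Module.End R M) (m : ℝ) (s : ℕ) :
    stTensor d R M (s - 1) →ₗ[R] stTensor d R M s × stTensor d R M (s - 1) :=
  (auxOp₁ D m s).prod (auxOp₂ D m s)

/-- The (square) operator of the extended system
`(φ, ψ) ↦ ((□ - m²) φ + X̂₁ ψ, ∂ · φ + X̂₂ ψ)`. -/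
def extendedOp (D : Fin d → Module.End R M) (m : ℝ) (s : ℕ) :
    stTensor d R M s × stTensor d R M (s - 1) →ₗ[R]
      stTensor d R M s × stTensor d R M (s - 1) :=
  (waveOp D m s).coprod (auxOp D m s)

end System

/-! ### Smooth fields on a domain -/

section Smooth

variable {d : ℕ}

/-- The space `C^∞(Ω)` of real functions on an open `Ω ⊆ ℝ^d`; each function is represented by its
extension by zero. -/
def smoothFn (Ω : TopologicalSpace.Opens (Fin d → ℝ)) : Submodule ℝ ((Fin d → ℝ) → ℝ) where
  carrier := {f | ContDiffOn ℝ ∞ f Ω ∧ ∀ x ∉ Ω, f x = 0}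
  add_mem' ha hb := ⟨ha.1.add hb.1, fun x hx => by simp [ha.2 x hx, hb.2 x hx]⟩
  zero_mem' := ⟨contDiffOn_const, fun _ _ => rfl⟩
  smul_mem' c f hf := ⟨hf.1.const_smul c, fun x hx => by simp [hf.2 x hx]⟩

open Classical in
/-- The partial derivative `∂ / ∂x^i` on `C^∞(Ω)`. -/
def partialDeriv (Ω : TopologicalSpace.Opens (Fin d → ℝ)) (i : Fin d) :
    Module.End ℝ (smoothFn Ω) where
  toFun f := ⟨fun x => if x ∈ Ω then fderiv ℝ f.1 x (Pi.single i 1) else 0, by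
    refine ⟨?_, fun x hx => if_neg hx⟩
    have h : ContDiffOn ℝ ∞ (fun x => fderiv ℝ f.1 x (Pi.single i 1)) Ω :=
      (f.2.1.fderiv_of_isOpen Ω.isOpen (by simp)).clm_apply contDiffOn_const
    exact h.congr fun x hx => if_pos hx⟩
  map_add' f g := by
    ext x
    by_cases hx : x ∈ Ω
    · have hf : DifferentiableAt ℝ f.1 x :=
        (f.2.1.differentiableOn (by simp)).differentiableAt (Ω.isOpen.mem_nhds hx)
      have hg : DifferentiableAt ℝ g.1 x :=
        (g.2.1.differentiableOn (by simp)).differentiableAt (Ω.isOpen.mem_nhds hx)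
      simp [hx, fderiv_add hf hg]
    · simp [hx]
  map_smul' c f := by
    ext x
    by_cases hx : x ∈ Ω
    · have hf : DifferentiableAt ℝ f.1 x :=
        (f.2.1.differentiableOn (by simp)).differentiableAt (Ω.isOpen.mem_nhds hx)
      simp [hx, fderiv_const_smul hf c]
    · simp [hx]

end Smooth

/-! ### Modules over the polynomial ring -/

section Symbols

/-- The ring `ℝ[p_1, …, p_d]`. -/
abbrev Poly (d : ℕ) : Type := MvPolynomial (Fin d) ℝ

/-- Multiplication by the indeterminate `p_i`, the symbol of `∂_i`. -/
def momentum {d : ℕ} (i : Fin d) : Module.End (Poly d) (Poly d) :=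
  LinearMap.mulLeft (Poly d) (MvPolynomial.X i)

/-- Symmetric traceless tensors of rank `k` with polynomial components. -/
abbrev polyST (d k : ℕ) : Submodule (Poly d) (Multiset (Fin d) → Poly d) :=
  stTensor d (Poly d) (Poly d) k

/-- The symbol matrix
`A = ((p² - m²) δ_{μ₁}^{ν₁} ⋯ δ_{μₛ}^{νₛ}, δ_{μ₁}^{ν₁} ⋯ δ_{μₛ₋₁}^{νₛ₋₁} p^{νₛ})_{st}`, acting on
columns: `(J', J'') ↦ (p² - m²) J' + (p ⊗ J'')_{st}`, where `(p ⊗ J'')_{st}` is the projection of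
the tensor product on its symmetric traceless part. (The averaged symmetrisation of `p ⊗ J''`
is `1 / s` times the symmetrised gradient.) -/
def symbolA (d s : ℕ) (m : ℝ) (hs : 1 ≤ s) :
    polyST d s × polyST d (s - 1) →ₗ[Poly d] polyST d s :=
  (kleinGordonST momentum m s).coprod
    (algebraMap ℝ (Poly d) (1 / s) • gradDiv momentum (s - 1) s 1 0 (by omega))

/-- The symbol matrix `A_1` of the compatibility operator, acting on columns:
`Y ↦ ((p ⊗ Y)_{st}, -(p² - m²) Y)`. -/
def symbolA₁ (d s : ℕ) (m : ℝ) (hs : 1 ≤ s) :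
    polyST d (s - 1) →ₗ[Poly d] polyST d s × polyST d (s - 1) :=
  (algebraMap ℝ (Poly d) (1 / s) • gradDiv momentum (s - 1) s 1 0 (by omega)).prod
    (-kleinGordonST momentum m (s - 1))

/-- The full contraction `S_{μ₁ ⋯ μₖ} T^{μ₁ ⋯ μₖ}` of two tensors of rank `k`. -/
def contraction {d : ℕ} (k : ℕ) (S T : Multiset (Fin d) → Poly d) : Poly d :=
  ∑ μ : Fin k → Fin d, (∏ i, algebraMap ℝ (Poly d) (eta (μ i))) *
    S (List.ofFn μ : Multiset (Fin d)) * T (List.ofFn μ : Multiset (Fin d))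

/-- The full contraction of pairs of symmetric traceless tensors of ranks `s` and `s - 1`. -/
def contractionPair {d s : ℕ} (J K : polyST d s × polyST d (s - 1)) : Poly d :=
  contraction s J.1.1 K.1.1 + contraction (s - 1) J.2.1 K.2.1

/-- `L` is a Lorentz transformation, i.e. an isometry of the Minkowski metric. -/
def IsLorentz {d : ℕ} (L : Matrix (Fin d) (Fin d) ℝ) : Prop :=
  L.transpose * Matrix.diagonal eta * L = Matrix.diagonal eta

/-- `K` is the Lorentz transform `K_{μ₁ ⋯ μₖ}(p) = L_{μ₁}^{ν₁} ⋯ L_{μₖ}^{νₖ} T_{ν₁ ⋯ νₖ}(L⁻¹ p)`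
of the tensor polynomial `T` (in every rank `k`). -/
def IsLorentzTransform {d : ℕ} (L : Matrix (Fin d) (Fin d) ℝ)
    (T K : Multiset (Fin d) → Poly d) : Prop :=
  ∀ (k : ℕ) (μ : Fin k → Fin d), K (List.ofFn μ : Multiset (Fin d)) =
    ∑ ν : Fin k → Fin d, (∏ i, algebraMap ℝ (Poly d) (L (μ i) (ν i))) *
      MvPolynomial.aeval (fun i => ∑ j, algebraMap ℝ (Poly d) (L⁻¹ i j) * MvPolynomial.X j)
        (T (List.ofFn ν : Multiset (Fin d)))

variable {P F₂ F₁ F₀ : Type*} [CommRing P] [AddCommGroup F₂] [Module P F₂]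
  [AddCommGroup F₁] [Module P F₁] [AddCommGroup F₀] [Module P F₀]

/-- A homomorphism (matrix) is unimodular if it has a left or a right inverse. -/
def IsUnimodular (f : F₁ →ₗ[P] F₀) : Prop :=
  (∃ g : F₀ →ₗ[P] F₁, g ∘ₗ f = LinearMap.id) ∨ (∃ g : F₀ →ₗ[P] F₁, f ∘ₗ g = LinearMap.id)

/-- `0 → F₂ → F₁ → F₀ → coker A → 0` is a resolution of `coker A` by finite free modules. -/
def IsOneStepResolution (A₁ : F₂ →ₗ[P] F₁) (A : F₁ →ₗ[P] F₀) : Prop :=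
  (Module.Free P F₂ ∧ Module.Finite P F₂) ∧ (Module.Free P F₁ ∧ Module.Finite P F₁) ∧
    (Module.Free P F₀ ∧ Module.Finite P F₀) ∧ Function.Injective A₁ ∧ Function.Exact A₁ A

/-- A homomorphism `A` of finite free modules is co-flat if it admits a one-step resolution
`0 → P^l → F₁ → F₀ → coker A → 0` with unimodular `P^l → F₁`. -/
def IsCoFlat (A : F₁ →ₗ[P] F₀) : Prop :=
  ∃ (l : ℕ) (A₁ : (Fin l → P) →ₗ[P] F₁), IsOneStepResolution A₁ A ∧ IsUnimodular A₁

end Symbols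

end MassiveSpin

/-! The operators `contract i` and `insertIdx j` obey the canonical commutation relations of
annihilation and creation operators. For any family `D` of commuting endomorphisms this gives `[div,
grad] = □`, `[tr, grad] = 2 div`, `[div, η] = grad`, `[grad, η] = 0`, where `η` is `metricMul`.
Partial derivatives and multiplications by indeterminates are both such families, so one computation
serves the fields and the symbols.

On traceless tensors of rank `k` the traceless gradient is `grad - 2/(d+2k-2) η div`. Iterating its
commutator with the divergence (`divergence_tracelessGradientPow`) expresses the divergence of a
traceless `n`-fold gradient by one `□` term and one term with a further divergence. In `∂·X̂⁽¹⁾ψ -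
(□-m²)X̂⁽²⁾ψ` the ratio `B_n/A_n` makes the `□` terms cancel. The recursion of `A_n` makes the term
with a further divergence cancel the mass term of the next summand. The sum telescopes to `m²B₁ψ =
ψ` (`compatOp_comp_auxOp`). The compatibility operator annihilates the wave operator, so applying it
to the extended system yields `ψ = 0`.

Transposition uses full contraction, which is nondegenerate on symmetric traceless tensors. Gradient
and divergence are adjoint up to factorials, as are metric and trace, and the traceless projection
may be dropped against a traceless tensor. Hence `X` is again a combination of the operators
`gradDiv`, and `XA₁ = 1` is the transpose of the telescoping identity. If `A(J', J'') = 0`, then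
`A₁J'' = -(p²-m²)J`; applying `X` and cancelling the nonzero scalar `p²-m²` gives `J = A₁XJ`, which
is exactness. The statements on the kernel and cokernel of `(X; A)` follow formally. Freeness holds
because tracelessness is a linear condition with real coefficients, and Lorentz invariance because
`X` is composed of invariant operations with real coefficients. -/

namespace MassiveSpin

/-! ### Commutation relations of gradient, divergence, trace and metric -/

section Commutation

variable {d : ℕ} {R M : Type*} [CommRing R] [Algebra ℝ R] [AddCommGroup M] [Module R M]

/-- The d'Alembert operator `η^{μν} D_μ D_ν`. -/
def box (D : Fin d → Module.End R M) : Module.End R M :=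
  ∑ i, algebraMap ℝ R (eta i) • (D i * D i)

theorem algebraMap_eta_mul_self (i : Fin d) :
    algebraMap ℝ R (eta i) * algebraMap ℝ R (eta i) = 1 := by
  rw [← map_mul, eta_mul_self, map_one]

theorem contract_insertIdx_apply (i j : Fin d) (T : Multiset (Fin d) → M) :
    contract (R := R) i (insertIdx (R := R) j T)
      = insertIdx (R := R) j (contract (R := R) i T) + if i = j then T else 0 := by
  have := LinearMap.congr_fun (contract_insertIdx (R := R) (M := M) i j) T
  simp only [Module.End.mul_apply, LinearMap.add_apply] at this
  rw [this]
  split_ifs <;> rfl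

theorem insertIdx_comm (i j : Fin d) (T : Multiset (Fin d) → M) :
    insertIdx (R := R) i (insertIdx (R := R) j T)
      = insertIdx (R := R) j (insertIdx (R := R) i T) := by
  by_cases h : i = j
  · rw [h]
  funext s
  simp only [insertIdx, LinearMap.coe_mk, AddHom.coe_mk]
  rw [Multiset.count_erase_of_ne (Ne.symm h), Multiset.count_erase_of_ne h,
    Multiset.erase_comm, smul_comm]

theorem compLeft_contract (f : M →ₗ[R] M) (i : Fin d) (T : Multiset (Fin d) → M) :
    contract (R := R) i (f.compLeft (Multiset (Fin d)) T)
      = f.compLeft (Multiset (Fin d)) (contract (R := R) i T) := rfl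

theorem compLeft_insertIdx (f : M →ₗ[R] M) (i : Fin d) (T : Multiset (Fin d) → M) :
    insertIdx (R := R) i (f.compLeft (Multiset (Fin d)) T)
      = f.compLeft (Multiset (Fin d)) (insertIdx (R := R) i T) := by
  funext s
  simp [insertIdx]

theorem compLeft_compLeft (f g : M →ₗ[R] M) (T : Multiset (Fin d) → M) :
    f.compLeft (Multiset (Fin d)) (g.compLeft (Multiset (Fin d)) T)
      = (f * g : Module.End R M).compLeft (Multiset (Fin d)) T := rfl

theorem metricMul_apply (T : Multiset (Fin d) → M) :
    metricMul (R := R) T = algebraMap ℝ R (1 / 2) • ∑ i, algebraMap ℝ R (eta i) •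
      insertIdx (R := R) i (insertIdx (R := R) i T) := by
  simp [metricMul]

theorem trace_apply (T : Multiset (Fin d) → M) :
    trace (R := R) T = ∑ i, algebraMap ℝ R (eta i) •
      contract (R := R) i (contract (R := R) i T) := by
  simp [trace]

theorem divergence_apply (D : Fin d → Module.End R M) (T : Multiset (Fin d) → M) :
    divergence D T = ∑ i, algebraMap ℝ R (eta i) •
      (D i).compLeft (Multiset (Fin d)) (contract (R := R) i T) := by
  simp [divergence]

theorem gradient_apply (D : Fin d → Module.End R M) (T : Multiset (Fin d) → M) :
    gradient D T = ∑ i, (D i).compLeft (Multiset (Fin d)) (insertIdx (R := R) i T) := by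
  simp [gradient]

theorem box_compLeft_apply (D : Fin d → Module.End R M) (T : Multiset (Fin d) → M) :
    (box D).compLeft (Multiset (Fin d)) T = ∑ i, algebraMap ℝ R (eta i) •
      (D i).compLeft (Multiset (Fin d)) ((D i).compLeft (Multiset (Fin d)) T) := by
  funext s
  simp [box]

theorem kleinGordon_eq (D : Fin d → Module.End R M) (m : ℝ) :
    kleinGordon D m = box D - algebraMap ℝ R (m ^ 2) • 1 := rfl

theorem kleinGordon_compLeft_apply (D : Fin d → Module.End R M) (m : ℝ)
    (T : Multiset (Fin d) → M) :
    (kleinGordon D m).compLeft (Multiset (Fin d)) T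
      = (box D).compLeft (Multiset (Fin d)) T - algebraMap ℝ R (m ^ 2) • T := by
  funext s
  simp [kleinGordon_eq]

theorem box_commute {D : Fin d → Module.End R M} (hD : ∀ i j, Commute (D i) (D j)) (i : Fin d) :
    Commute (box D) (D i) :=
  Commute.sum_left _ _ _ fun j _ => ((hD j i).mul_left (hD j i)).smul_left _

theorem kleinGordon_commute {D : Fin d → Module.End R M} (hD : ∀ i j, Commute (D i) (D j))
    (m : ℝ) (i : Fin d) : Commute (kleinGordon D m) (D i) :=
  (box_commute hD i).sub_left ((Commute.one_left _).smul_left _)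

theorem compLeft_metricMul (f : M →ₗ[R] M) (T : Multiset (Fin d) → M) :
    metricMul (R := R) (f.compLeft (Multiset (Fin d)) T)
      = f.compLeft (Multiset (Fin d)) (metricMul (R := R) T) := by
  simp only [metricMul_apply, compLeft_insertIdx, map_smul, map_sum]

theorem compLeft_divergence {D : Fin d → Module.End R M} {f : Module.End R M}
    (hf : ∀ i, Commute f (D i)) (T : Multiset (Fin d) → M) :
    divergence D (f.compLeft (Multiset (Fin d)) T)
      = f.compLeft (Multiset (Fin d)) (divergence D T) := by
  simp only [divergence_apply, compLeft_contract, map_smul, map_sum, compLeft_compLeft, (hf _).eq]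

theorem compLeft_gradient {D : Fin d → Module.End R M} {f : Module.End R M}
    (hf : ∀ i, Commute f (D i)) (T : Multiset (Fin d) → M) :
    gradient D (f.compLeft (Multiset (Fin d)) T)
      = f.compLeft (Multiset (Fin d)) (gradient D T) := by
  simp only [gradient_apply, compLeft_insertIdx, map_sum, compLeft_compLeft, (hf _).eq]

/-- Moving `contract i` past `insertIdx j` leaves a remainder only for `i = j`, and these remainders
sum to `□`. The other terms are reordered by commutativity of the `D`'s. The next two relations
arise in the same way, with remainders from two contractions or two insertions. -/
theorem divergence_gradient {D : Fin d → Module.End R M} (hD : ∀ i j, Commute (D i) (D j))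
    (T : Multiset (Fin d) → M) :
    divergence D (gradient D T)
      = (box D).compLeft (Multiset (Fin d)) T + gradient D (divergence D T) := by
  have e : ∀ i j, (if i = j then (D j).compLeft (Multiset (Fin d)) T else 0)
      = (D j).compLeft (Multiset (Fin d)) (if i = j then T else 0) := by
    intro i j; split_ifs <;> simp
  simp only [divergence_apply, gradient_apply, map_sum, map_smul, compLeft_contract,
    contract_insertIdx_apply, compLeft_insertIdx, map_add, Finset.sum_add_distrib, smul_add,
    box_compLeft_apply, Finset.smul_sum, ← e]
  rw [add_comm]
  congr 1
  · refine Finset.sum_congr rfl fun i _ => ?_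
    rw [Finset.sum_eq_single i]
    · simp
    · intro j _ h; simp [h]
    · simp
  · rw [Finset.sum_comm]
    refine Finset.sum_congr rfl fun i _ => Finset.sum_congr rfl fun j _ => ?_
    rw [compLeft_compLeft, compLeft_compLeft, (hD _ _).eq]

theorem trace_gradient (D : Fin d → Module.End R M) (T : Multiset (Fin d) → M) :
    trace (R := R) (gradient D T)
      = (2 : R) • divergence D T + gradient D (trace (R := R) T) := by
  have key : ∀ i j : Fin d, contract (R := R) i (contract (R := R) i (insertIdx (R := R) j T))
      = insertIdx (R := R) j (contract (R := R) i (contract (R := R) i T))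
        + if i = j then (2 : R) • contract (R := R) i T else 0 := by
    intro i j
    rw [contract_insertIdx_apply, map_add, contract_insertIdx_apply]
    split_ifs
    · rw [add_assoc, two_smul]
    · simp
  have e : ∀ i j, (D j).compLeft (Multiset (Fin d))
      (if i = j then (2 : R) • contract (R := R) i T else 0)
      = if i = j then (2 : R) • (D j).compLeft (Multiset (Fin d)) (contract (R := R) i T)
        else 0 := by
    intro i j; split_ifs <;> simp
  simp only [gradient_apply, map_sum, trace_compLeft]
  simp only [trace_apply, key, map_sum, map_smul, smul_add, Finset.sum_add_distrib, map_add, e]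
  rw [add_comm]
  congr 1
  rw [Finset.sum_comm, divergence_apply, Finset.smul_sum]
  refine Finset.sum_congr rfl fun i _ => ?_
  simp [smul_comm (2 : R)]

theorem divergence_metricMul (D : Fin d → Module.End R M) (T : Multiset (Fin d) → M) :
    divergence D (metricMul (R := R) T)
      = gradient D T + metricMul (R := R) (divergence D T) := by
  have key : ∀ i j : Fin d, contract (R := R) i (insertIdx (R := R) j (insertIdx (R := R) j T))
      = insertIdx (R := R) j (insertIdx (R := R) j (contract (R := R) i T))
        + if i = j then (2 : R) • insertIdx (R := R) i T else 0 := by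
    intro i j
    rw [contract_insertIdx_apply, contract_insertIdx_apply, map_add, add_assoc]
    congr 1
    split_ifs with h
    · rw [h, two_smul]
    · simp
  have e : ∀ i j, (D i).compLeft (Multiset (Fin d))
      (if i = j then (2 : R) • insertIdx (R := R) i T else 0)
      = if i = j then (2 : R) • (D i).compLeft (Multiset (Fin d)) (insertIdx (R := R) i T)
        else 0 := by
    intro i j; split_ifs <;> simp
  simp only [metricMul_apply, divergence_apply, map_sum, map_smul, key, map_add, smul_add,
    Finset.sum_add_distrib, compLeft_insertIdx, e, Finset.smul_sum]
  rw [add_comm]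
  congr 1
  · rw [gradient_apply, Finset.sum_comm]
    refine Finset.sum_congr rfl fun i _ => ?_
    simp only [smul_ite, smul_zero, Finset.sum_ite_eq, Finset.mem_univ, if_true, smul_smul]
    conv_rhs => rw [← one_smul R ((D i).compLeft (Multiset (Fin d)) _)]
    congr 1
    have hh : algebraMap ℝ R (1 / 2) * 2 = 1 := by
      rw [← map_ofNat (algebraMap ℝ R) 2, ← map_mul]; norm_num
    linear_combination algebraMap_eta_mul_self (R := R) i + algebraMap ℝ R (eta i) ^ 2 * hh
  · rw [Finset.sum_comm]
    refine Finset.sum_congr rfl fun i _ => Finset.sum_congr rfl fun j _ => ?_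
    simp only [smul_smul]
    congr 1
    ring

theorem gradient_metricMul (D : Fin d → Module.End R M) (T : Multiset (Fin d) → M) :
    gradient D (metricMul (R := R) T) = metricMul (R := R) (gradient D T) := by
  simp only [gradient_apply, metricMul_apply, map_sum, map_smul, compLeft_insertIdx,
    Finset.smul_sum]
  rw [Finset.sum_comm]
  refine Finset.sum_congr rfl fun i _ => Finset.sum_congr rfl fun j _ => ?_
  rw [insertIdx_comm j i, insertIdx_comm j i]

end Commutation

/-! ### Traceless projection and iterated traceless gradients -/

section TracelessGradient

variable {d : ℕ} {R M : Type*} [CommRing R] [Algebra ℝ R] [AddCommGroup M] [Module R M]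

/-- Multiplying the trace identity `trace_metricMul_pow` by the metric shows that `η^(j+2) tr U` is
a nonzero multiple of `η^(j+1) U`, hence traceless as well. Its seed `tr U` has smaller rank, so
induction on the rank applies; all powers are treated together because the exponent grows. No
definiteness of the metric enters. -/
theorem trace_metricMul_add_pow_eq_zero (hd : 0 < d) (r : ℕ) : ∀ (j : ℕ)
    {U : Multiset (Fin d) → M}, U ∈ symTensor d R M r →
      trace (R := R) ((metricMul (R := R) ^ (j + 1)) U) = 0 →
      (metricMul (R := R) ^ (j + 1)) U = 0 := by
  induction r using Nat.strong_induction_on with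
  | _ r ih =>
    intro j U hU h
    have hpos : (0 : ℝ) < (j + 1) * (d + 2 * r + 2 * j) := by
      have : (0 : ℝ) < d := by exact_mod_cast hd
      positivity
    have h1 := trace_metricMul_pow hU j
    rw [h] at h1
    have h2 : (metricMul (R := R) ^ (j + 1 + 1)) (trace (R := R) U)
        = -(algebraMap ℝ R ((j + 1) * (d + 2 * r + 2 * j)) •
          (metricMul (R := R) ^ (j + 1)) U) := by
      have h3 := congrArg (metricMul (R := R)) h1
      have hp : ∀ (i : ℕ) (V : Multiset (Fin d) → M), metricMul (R := R)
          ((metricMul (R := R) ^ i) V) = (metricMul (R := R) ^ (i + 1)) V := fun i V => by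
        rw [pow_succ', Module.End.mul_apply]
      rw [map_zero, map_add, map_smul, hp, hp] at h3
      exact eq_neg_of_add_eq_zero_left h3.symm
    have h4 : (metricMul (R := R) ^ (j + 1 + 1)) (trace (R := R) U) = 0 := by
      rcases lt_or_ge r 2 with hr | hr
      · rw [trace_eq_zero hr hU, map_zero]
      · refine ih (r - 2) (by omega) (j + 1) (trace_mem hU) ?_
        rw [h2, map_neg, map_smul, h, smul_zero, neg_zero]
    rw [h4, eq_comm, neg_eq_zero] at h2
    have h5 := congrArg (algebraMap ℝ R ((j + 1) * (d + 2 * r + 2 * j))⁻¹ • ·) h2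
    simpa only [smul_smul, ← map_mul, inv_mul_cancel₀ hpos.ne', map_one, one_smul, smul_zero]
      using h5

theorem metricMul_eq_zero_of_trace (hd : 0 < d) {r : ℕ} {U : Multiset (Fin d) → M}
    (hU : U ∈ symTensor d R M r) (h : trace (R := R) (metricMul (R := R) U) = 0) :
    metricMul (R := R) U = 0 := by
  simpa using trace_metricMul_add_pow_eq_zero hd r 0 hU (by simpa using h)

theorem tracelessPart_of_trace_eq_zero (k : ℕ) {T : Multiset (Fin d) → M}
    (hT : trace (R := R) T = 0) : tracelessPart (R := R) k T = T := by
  rw [tracelessPart, Finset.sum_range_succ', LinearMap.add_apply, LinearMap.sum_apply,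
    Finset.sum_eq_zero]
  · simp [tracelessCoeff]
  · intro j _
    rw [LinearMap.smul_apply, Module.End.mul_apply, pow_succ (trace (R := R)),
      Module.End.mul_apply, hT, map_zero, map_zero, smul_zero]

/-- The traceless part of a multiple of the metric differs from it by a multiple of the metric, so
it is a traceless multiple of the metric, which must vanish. -/
theorem tracelessPart_metricMul (hd : 0 < d) {r : ℕ} {U : Multiset (Fin d) → M}
    (hU : U ∈ symTensor d R M r) :
    tracelessPart (R := R) (r + 2) (metricMul (R := R) U) = 0 := by
  have hm := metricMul_mem hU
  rcases exists_sub_tracelessPart_eq hm with ⟨h, _⟩ | ⟨Θ, hΘ, h⟩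
  · omega
  · have h1 : tracelessPart (R := R) (r + 2) (metricMul (R := R) U)
        = metricMul (R := R) (U - Θ) := by
      rw [map_sub, ← h, sub_sub_cancel]
    rw [h1]
    refine metricMul_eq_zero_of_trace hd (Submodule.sub_mem _ hU hΘ) ?_
    rw [← h1]
    exact (tracelessPart_mem hm).2

/-- The traceless part of the gradient of a symmetric traceless tensor of rank `k`. -/
def tracelessGradient (D : Fin d → Module.End R M) (k : ℕ) :
    Module.End R (Multiset (Fin d) → M) :=
  gradient D - algebraMap ℝ R (2 / (d + 2 * k - 2)) • (metricMul * divergence D)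

theorem tracelessGradient_apply (D : Fin d → Module.End R M) (k : ℕ)
    (T : Multiset (Fin d) → M) :
    tracelessGradient D k T = gradient D T
      - algebraMap ℝ R (2 / (d + 2 * k - 2)) • metricMul (R := R) (divergence D T) := rfl

theorem divergence_rank_zero (D : Fin d → Module.End R M) {T : Multiset (Fin d) → M}
    (hT : T ∈ symTensor d R M 0) : divergence D T = 0 := by
  rw [divergence_apply]
  refine Finset.sum_eq_zero fun i _ => ?_
  have : contract (R := R) i T = 0 := by
    funext s
    exact hT _ (by simp)
  rw [this, map_zero, smul_zero]

/-- The trace of the gradient is `2 div T` and that of `η div T` is `(d + 2(k-1)) div T`; this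
dictates the coefficient in `tracelessGradient`. -/
theorem tracelessGradient_mem (hd : 2 ≤ d) (D : Fin d → Module.End R M) {k : ℕ}
    {T : Multiset (Fin d) → M} (hT : T ∈ stTensor d R M k) :
    tracelessGradient D k T ∈ stTensor d R M (k + 1) := by
  -- Rank zero is separate: `k - 1` truncates, and for `d = 2` the denominator `d + 2k - 2`
  -- vanishes. The divergence is then zero anyway.
  rcases Nat.eq_zero_or_pos k with rfl | hk
  · rw [tracelessGradient_apply, divergence_rank_zero D hT.1, map_zero, smul_zero, sub_zero]
    exact mem_stTensor.2 ⟨gradient_mem hT.1 D, trace_eq_zero (by norm_num) (gradient_mem hT.1 D)⟩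
  have hdiv := divergence_mem_stTensor hT D
  refine mem_stTensor.2 ⟨Submodule.sub_mem _ (gradient_mem hT.1 D)
    (Submodule.smul_mem _ _ ?_), ?_⟩
  · have := metricMul_mem hdiv.1
    rwa [show k - 1 + 2 = k + 1 by omega] at this
  · have hpos : (d : ℝ) + 2 * k - 2 ≠ 0 := by
      have : (1 : ℝ) ≤ k := by exact_mod_cast hk
      have : (2 : ℝ) ≤ d := by exact_mod_cast hd
      linarith
    rw [tracelessGradient_apply, map_sub, map_smul, trace_gradient, (mem_stTensor.1 hT).2,
      trace_metricMul hdiv.1, (mem_stTensor.1 hdiv).2, map_zero, map_zero, add_zero, add_zero,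
      smul_smul, ← map_mul, Nat.cast_sub hk, ← sub_smul,
      show 2 / ((d : ℝ) + 2 * k - 2) * (d + 2 * (k - (1 : ℕ))) = 2 by
        push_cast; field_simp; ring, map_ofNat, sub_self, zero_smul]

theorem divergence_tracelessGradient (hd : 2 ≤ d) {D : Fin d → Module.End R M}
    (hD : ∀ i j, Commute (D i) (D j)) {k : ℕ} {T : Multiset (Fin d) → M}
    (hT : T ∈ stTensor d R M k) :
    divergence D (tracelessGradient D k T) = (box D).compLeft (Multiset (Fin d)) T
      + algebraMap ℝ R ((d + 2 * k - 4) / (d + 2 * k - 2)) •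
        tracelessGradient D (k - 1) (divergence D T) := by
  rcases Nat.eq_zero_or_pos k with rfl | hk
  · rw [tracelessGradient_apply, divergence_rank_zero D hT.1, map_zero, smul_zero, sub_zero,
      divergence_gradient hD, divergence_rank_zero D hT.1, map_zero, map_zero, smul_zero]
  have hk1 : (1 : ℝ) ≤ k := by exact_mod_cast hk
  have hd2 : (2 : ℝ) ≤ d := by exact_mod_cast hd
  have hpos : (d : ℝ) + 2 * k - 2 ≠ 0 := by linarith
  have h1 : algebraMap ℝ R ((d + 2 * k - 4) / (d + 2 * k - 2))
      = 1 - algebraMap ℝ R (2 / (d + 2 * k - 2)) := by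
    rw [← map_one (algebraMap ℝ R), ← map_sub]
    congr 1
    field_simp
    ring
  -- The denominator in the traceless gradient of rank `k - 1` is the numerator `d + 2k - 4`. It can
  -- vanish only for `k = 1`, `d = 2`, and in rank one the double divergence is zero.
  have h2 : algebraMap ℝ R ((d + 2 * k - 4) / (d + 2 * k - 2)) •
      algebraMap ℝ R (2 / (d + 2 * (k - 1 : ℕ) - 2)) •
        metricMul (R := R) (divergence D (divergence D T))
      = algebraMap ℝ R (2 / (d + 2 * k - 2)) •
        metricMul (R := R) (divergence D (divergence D T)) := by
    rcases eq_or_ne k 1 with rfl | hk'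
    · rw [divergence_rank_zero D (divergence_mem hT.1 D), map_zero, smul_zero, smul_zero,
        smul_zero]
    · have hk2 : (2 : ℝ) ≤ k := by exact_mod_cast (show 2 ≤ k by omega)
      have hpos' : (d : ℝ) + 2 * k - 4 ≠ 0 := by linarith
      rw [smul_smul, ← map_mul, Nat.cast_sub hk]
      congr 2
      rw [show (d : ℝ) + 2 * (k - (1 : ℕ)) - 2 = d + 2 * k - 4 by push_cast; ring]
      field_simp
  rw [tracelessGradient_apply, tracelessGradient_apply, map_sub, map_smul, divergence_gradient hD,
    divergence_metricMul, smul_sub, h2, h1, sub_smul, one_smul, smul_add]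
  abel

/-- For commuting `D`, this is `n!` times the traceless symmetrised `n`-fold gradient. -/
def tracelessGradientPow (D : Fin d → Module.End R M) (t n : ℕ) :
    Module.End R (Multiset (Fin d) → M) :=
  tracelessPart t * gradient D ^ n

theorem tracelessGradientPow_zero (D : Fin d → Module.End R M) {k : ℕ}
    {T : Multiset (Fin d) → M} (hT : T ∈ stTensor d R M k) (t : ℕ) :
    tracelessGradientPow D t 0 T = T := by
  simpa [tracelessGradientPow] using tracelessPart_of_trace_eq_zero t hT.2

theorem tracelessGradientPow_mem (D : Fin d → Module.End R M) {k : ℕ}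
    {T : Multiset (Fin d) → M} (hT : T ∈ symTensor d R M k) (n : ℕ) :
    tracelessGradientPow D (k + n) n T ∈ stTensor d R M (k + n) :=
  tracelessPart_mem (gradient_pow_mem hT D n)

/-- Since the gradient commutes with multiplication by the metric, the part removed by an early
projection remains a multiple of the metric and is removed by the final one. Projecting at every
step is therefore the same as projecting once. -/
theorem tracelessGradientPow_succ (hd : 2 ≤ d) (D : Fin d → Module.End R M) {k : ℕ}
    {T : Multiset (Fin d) → M} (hT : T ∈ symTensor d R M k) (n : ℕ) :
    tracelessGradientPow D (k + (n + 1)) (n + 1) T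
      = tracelessGradient D (k + n) (tracelessGradientPow D (k + n) n T) := by
  have hd0 : 0 < d := by omega
  have key : ∀ {r : ℕ} {U : Multiset (Fin d) → M}, U ∈ stTensor d R M r →
      tracelessPart (R := R) (r + 1) (gradient D U) = tracelessGradient D r U := by
    intro r U hU
    have h1 : gradient D U = tracelessGradient D r U
        + metricMul (R := R) (algebraMap ℝ R (2 / (d + 2 * r - 2)) • divergence D U) := by
      rw [tracelessGradient_apply, map_smul, sub_add_cancel]
    rw [h1, map_add, tracelessPart_of_trace_eq_zero _ (tracelessGradient_mem hd D hU).2]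
    rcases Nat.eq_zero_or_pos r with rfl | hr
    · rw [divergence_rank_zero D hU.1, smul_zero, map_zero, map_zero, add_zero]
    · have := tracelessPart_metricMul hd0 (Submodule.smul_mem _
        (algebraMap ℝ R (2 / (d + 2 * r - 2))) (divergence_mem hU.1 D))
      rw [show r - 1 + 2 = r + 1 by omega] at this
      rw [this, add_zero]
  rw [← key (tracelessGradientPow_mem D hT n)]
  simp only [tracelessGradientPow, Module.End.mul_apply, pow_succ' (gradient D)]
  have hg := gradient_pow_mem hT D n
  rcases exists_sub_tracelessPart_eq hg with ⟨_, h⟩ | ⟨Θ, hΘ, h⟩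
  · rw [h]; rfl
  -- For rank below two the subtraction in the rank of `Θ` would truncate; there every tensor is
  -- already traceless.
  · rcases lt_or_ge (k + n) 2 with h2 | h2
    · rw [tracelessPart_of_trace_eq_zero (k + n) (trace_eq_zero h2 hg)]; rfl
    · conv_lhs => rw [eq_add_of_sub_eq' h, map_add, map_add, gradient_metricMul]
      have := tracelessPart_metricMul hd0 (gradient_mem hΘ D)
      rw [show k + n - 2 + 1 + 2 = k + (n + 1) by omega] at this
      rw [this, add_zero]
      rfl

theorem compLeft_tracelessGradient {D : Fin d → Module.End R M} {f : Module.End R M}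
    (hf : ∀ i, Commute f (D i)) (k : ℕ) (T : Multiset (Fin d) → M) :
    tracelessGradient D k (f.compLeft (Multiset (Fin d)) T)
      = f.compLeft (Multiset (Fin d)) (tracelessGradient D k T) := by
  rw [tracelessGradient_apply, tracelessGradient_apply, compLeft_gradient hf,
    compLeft_divergence hf, compLeft_metricMul, map_sub, map_smul]

/-- The factor on the left clears denominators, so the case `d = 2`, `k = n = 0` is included. -/
theorem divergence_tracelessGradientPow (hd : 2 ≤ d) {D : Fin d → Module.End R M}
    (hD : ∀ i j, Commute (D i) (D j)) {k : ℕ} {T : Multiset (Fin d) → M}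
    (hT : T ∈ stTensor d R M k) (n : ℕ) :
    algebraMap ℝ R (d + 2 * k + 2 * n - 2) •
        divergence D (tracelessGradientPow D (k + (n + 1)) (n + 1) T)
      = algebraMap ℝ R ((n + 1) * (d + 2 * k + n - 2)) •
          (box D).compLeft (Multiset (Fin d)) (tracelessGradientPow D (k + n) n T)
        + algebraMap ℝ R (d + 2 * k - 4) •
          tracelessGradientPow D (k - 1 + (n + 1)) (n + 1) (divergence D T) := by
  have hd2 : (2 : ℝ) ≤ d := by exact_mod_cast hd
  have hk0 : (0 : ℝ) ≤ k := Nat.cast_nonneg k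
  have hdiv := divergence_mem_stTensor hT D
  induction n with
  | zero =>
    rw [tracelessGradientPow_succ hd D hT.1, tracelessGradientPow_succ hd D hdiv.1,
      tracelessGradientPow_zero D hT, tracelessGradientPow_zero D hdiv, add_zero, add_zero,
      divergence_tracelessGradient hd hD hT, smul_add, smul_smul, ← map_mul]
    rcases eq_or_ne ((d : ℝ) + 2 * k - 2) 0 with h0 | h0
    · have hk : k = 0 := by
        have : (k : ℝ) = 0 := by linarith
        exact_mod_cast this
      subst hk
      rw [divergence_rank_zero D hT.1, map_zero, smul_zero, smul_zero]
      simp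
    · congr 3
      · push_cast; ring
      · push_cast
        rw [mul_zero, add_zero, mul_div_cancel₀ _ h0]
  | succ n ih =>
    have hn0 : (0 : ℝ) ≤ n := Nat.cast_nonneg n
    have h0 : (d : ℝ) + 2 * (k + (n + 1) : ℕ) - 2 ≠ 0 := by push_cast; linarith
    rw [tracelessGradientPow_succ hd D hT.1,
      divergence_tracelessGradient hd hD (tracelessGradientPow_mem D hT.1 (n + 1)),
      tracelessGradientPow_succ hd D hdiv.1, smul_add, smul_smul, ← map_mul]
    -- The new prefactor times the ratio from `divergence_tracelessGradient` is the old prefactor,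
    -- so the induction hypothesis fits. The `□` coefficients then add up by `(n+1)(a+n-2) + (a+2n)
    -- = (n+2)(a+n-1)`, with `a = d+2k`.
    have e1 : ((d : ℝ) + 2 * k + 2 * (n + 1 : ℕ) - 2) *
        ((d + 2 * (k + (n + 1) : ℕ) - 4) / (d + 2 * (k + (n + 1) : ℕ) - 2))
        = d + 2 * k + 2 * n - 2 := by
      rw [show (d : ℝ) + 2 * k + 2 * (n + 1 : ℕ) - 2 = d + 2 * (k + (n + 1) : ℕ) - 2 by
        push_cast; ring, mul_div_cancel₀ _ h0]
      push_cast; ring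
    rw [e1, ← map_smul (tracelessGradient D _), ih, map_add, map_smul, map_smul,
      show k + (n + 1) - 1 = k + n by omega,
      compLeft_tracelessGradient (box_commute hD), ← tracelessGradientPow_succ hd D hT.1,
      ← add_assoc, ← add_smul, ← map_add]
    congr 1
    · congr 2
      push_cast; ring
    · rcases Nat.eq_zero_or_pos k with rfl | hk
      · rw [divergence_rank_zero D hT.1, map_zero, map_zero, map_zero]
      · rw [show k - 1 + (n + 1) = k + n by omega]

end TracelessGradient

/-! ### Recursions for the coefficients `A_n` and `B_n` -/

section Coefficients

theorem coeffA_succ (d s : ℕ) (m : ℝ) (l : ℕ) :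
    coeffA d s m (l + 2) = coeffA d s m (l + 1) * (-1 / m ^ 2) *
      ((2 * (s : ℝ) + d - 4 - 2 * (l + 1)) / (2 * (s : ℝ) + d - 4 - (l + 1))) := by
  unfold coeffA
  rw [show l + 2 - 1 = l + 1 by omega, show l + 1 - 1 = l by omega,
    Finset.prod_Icc_succ_top (by omega), pow_succ]
  push_cast
  ring

theorem coeffB_one (d s : ℕ) (m : ℝ) : coeffB d s m 1 = 1 / m ^ 2 := by
  simp [coeffB]

theorem coeffA_one (d s : ℕ) (m : ℝ) : coeffA d s m 1 = 1 / m ^ 2 := by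
  simp [coeffA]

theorem coeffB_add_two (d s : ℕ) (m : ℝ) (l : ℕ) :
    coeffB d s m (l + 2) = (2 * (s : ℝ) + d - 4 - (l + 1)) / (2 * (s : ℝ) + d - 4) *
      coeffA d s m (l + 2) := by
  rw [coeffB, if_neg (by omega)]
  push_cast
  ring

/-- The case distinction matters where `2s + d - 4 = 0`; for `s ≥ 1`, `d ≥ 2` this is only `s = 1`,
`d = 2`. -/
theorem coeffB_eq_coeffA {d s : ℕ} (m : ℝ) {l : ℕ} :
    coeffB d s m (l + 1) = coeffA d s m (l + 1) *
      (if l = 0 then 1 else (2 * (s : ℝ) + d - 4 - l) / (2 * (s : ℝ) + d - 4)) := by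
  cases l with
  | zero => simp [coeffA_one, coeffB_one]
  | succ l => rw [coeffB_add_two, if_neg (by omega)]; push_cast; ring

/-- This is the telescoping condition: the numerator of `B_n/A_n` cancels the last denominator in
the product defining `A_n`. -/
theorem coeffB_add_two_eq {d s : ℕ} (hd : 2 ≤ d) {m : ℝ} (hm : m ≠ 0) {l : ℕ} (hl : l + 1 < s) :
    m ^ 2 * coeffB d s m (l + 2) = -(coeffA d s m (l + 1) *
      ((2 * (s : ℝ) + d - 4 - 2 * (l + 1)) / (2 * (s : ℝ) + d - 4))) := by
  have h1 : (l : ℝ) + 2 ≤ s := by exact_mod_cast hl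
  have h2 : (2 : ℝ) ≤ d := by exact_mod_cast hd
  have h3 : (0 : ℝ) ≤ l := Nat.cast_nonneg l
  have h4 : 2 * (s : ℝ) + d - 4 - (l + 1) ≠ 0 := by linarith
  have h5 : 2 * (s : ℝ) + d - 4 ≠ 0 := by linarith
  rw [coeffB_add_two, coeffA_succ]
  field_simp

end Coefficients

/-! ### The telescoping identity and the extended system -/

section LeftInverse

variable {d : ℕ} {R M : Type*} [CommRing R] [Algebra ℝ R] [AddCommGroup M] [Module R M]

theorem divergence_pow_mem_stTensor {k : ℕ} {T : Multiset (Fin d) → M}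
    (hT : T ∈ stTensor d R M k) (D : Fin d → Module.End R M) (l : ℕ) :
    (divergence D ^ l) T ∈ stTensor d R M (k - l) := by
  induction l with
  | zero => exact hT
  | succ l ih =>
    rw [pow_succ', Module.End.mul_apply]
    exact divergence_mem_stTensor ih D

theorem divergence_pow_eq_zero (D : Fin d → Module.End R M) {k : ℕ} {T : Multiset (Fin d) → M}
    (hT : T ∈ symTensor d R M k) {l : ℕ} (hl : k < l) : (divergence D ^ l) T = 0 := by
  obtain ⟨j, rfl⟩ := Nat.exists_eq_add_of_lt hl
  rw [show k + j + 1 = j + (k + 1) by ring, pow_add, Module.End.mul_apply, pow_succ',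
    Module.End.mul_apply, divergence_rank_zero D, map_zero]
  simpa using divergence_pow_mem hT D k

theorem gradDiv_coe (D : Fin d → Module.End R M) (k t n l : ℕ) (h : k - l + n = t)
    (T : stTensor d R M k) : (gradDiv D k t n l h T).1 = algebraMap ℝ R (1 / n.factorial) •
      tracelessGradientPow D t n ((divergence D ^ l) T.1) := rfl

theorem kleinGordonST_coe (D : Fin d → Module.End R M) (m : ℝ) (k : ℕ) (T : stTensor d R M k) :
    (kleinGordonST D m k T).1 = (kleinGordon D m).compLeft (Multiset (Fin d)) T.1 := rfl

theorem divergenceST_coe (D : Fin d → Module.End R M) (k : ℕ) (T : stTensor d R M k) :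
    (divergenceST D k T).1 = divergence D T.1 := rfl

theorem auxOp₁_coe (D : Fin d → Module.End R M) (m : ℝ) (s : ℕ) (ψ : stTensor d R M (s - 1)) :
    (auxOp₁ D m s ψ).1 = ∑ l ∈ Finset.range s, algebraMap ℝ R (coeffA d s m (l + 1)) •
      algebraMap ℝ R (1 / (l + 1).factorial) •
        tracelessGradientPow D s (l + 1) ((divergence D ^ l) ψ.1) := by
  rw [auxOp₁, LinearMap.sum_apply, AddSubmonoidClass.coe_finsetSum, Finset.sum_range]
  rfl

theorem auxOp₂_coe (D : Fin d → Module.End R M) (m : ℝ) (s : ℕ) (ψ : stTensor d R M (s - 1)) :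
    (auxOp₂ D m s ψ).1 = ∑ l ∈ Finset.range s, algebraMap ℝ R (coeffB d s m (l + 1)) •
      algebraMap ℝ R (1 / l.factorial) •
        tracelessGradientPow D (s - 1) l ((divergence D ^ l) ψ.1) := by
  rw [auxOp₂, LinearMap.sum_apply, AddSubmonoidClass.coe_finsetSum, Finset.sum_range]
  rfl

/-- For `k = s - 1 - l` and `n = l` the prefactor `d + 2k + 2n - 2` equals `2s + d - 4` for every
`l`, which explains the common denominator. -/
theorem divergence_tracelessGradientPow_divergence_pow (hd : 2 ≤ d) {D : Fin d → Module.End R M}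
    (hD : ∀ i j, Commute (D i) (D j)) {s : ℕ} {ψ : Multiset (Fin d) → M}
    (hψ : ψ ∈ stTensor d R M (s - 1)) {l : ℕ} (hl : l < s) :
    divergence D (tracelessGradientPow D s (l + 1) ((divergence D ^ l) ψ))
      = algebraMap ℝ R ((l + 1) *
          (if l = 0 then 1 else (2 * (s : ℝ) + d - 4 - l) / (2 * (s : ℝ) + d - 4))) •
          (box D).compLeft (Multiset (Fin d))
            (tracelessGradientPow D (s - 1) l ((divergence D ^ l) ψ))
        + algebraMap ℝ R ((2 * (s : ℝ) + d - 4 - 2 * (l + 1)) / (2 * (s : ℝ) + d - 4)) •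
          tracelessGradientPow D (s - 1) (l + 1) ((divergence D ^ (l + 1)) ψ) := by
  have hχ := divergence_pow_mem_stTensor hψ D l
  have hd2 : (2 : ℝ) ≤ d := by exact_mod_cast hd
  -- For `s = 1` the denominator is `d - 2` and may vanish, so the scalar case is computed directly.
  rcases eq_or_ne s 1 with rfl | hs
  · obtain rfl : l = 0 := by omega
    rw [divergence_pow_eq_zero D hψ.1 (l := 0 + 1) (by norm_num), map_zero, smul_zero, add_zero,
      pow_zero,
      Module.End.one_apply, tracelessGradientPow_zero D hψ]
    have h1 := tracelessGradientPow_succ hd D hψ.1 0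
    have h2 := divergence_tracelessGradient hd hD hψ
    rw [tracelessGradientPow_zero D hψ] at h1
    rw [divergence_rank_zero D hψ.1, map_zero, smul_zero, add_zero] at h2
    simpa using (congrArg (divergence D) h1).trans h2
  have hs2 : (2 : ℝ) ≤ s := by exact_mod_cast (show 2 ≤ s by omega)
  have hE : 2 * (s : ℝ) + d - 4 ≠ 0 := by linarith
  have h := divergence_tracelessGradientPow hd hD hχ l
  rw [show s - 1 - l + (l + 1) = s by omega, show s - 1 - l + l = s - 1 by omega,
    ← Module.End.mul_apply (divergence D) (divergence D ^ l), ← pow_succ'] at h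
  have hk : ((s - 1 - l : ℕ) : ℝ) = s - 1 - l := by
    rw [Nat.cast_sub (by omega), Nat.cast_sub (by omega), Nat.cast_one]
  -- At `l + 1 = s` the rank on the left truncates to the wrong value, but the `s`-fold divergence
  -- of a tensor of rank `s - 1` is zero.
  have h3 : tracelessGradientPow D (s - 1 - l - 1 + (l + 1)) (l + 1) ((divergence D ^ (l + 1)) ψ)
      = tracelessGradientPow D (s - 1) (l + 1) ((divergence D ^ (l + 1)) ψ) := by
    rcases Nat.lt_or_ge (l + 1) s with h' | h'
    · rw [show s - 1 - l - 1 + (l + 1) = s - 1 by omega]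
    · rw [divergence_pow_eq_zero D hψ.1 (by omega), map_zero, map_zero]
  rw [h3, hk] at h
  have h4 := congrArg (algebraMap ℝ R (2 * (s : ℝ) + d - 4)⁻¹ • ·) h
  simp only [smul_add, smul_smul, ← map_mul] at h4
  rw [show (2 * (s : ℝ) + d - 4)⁻¹ * (d + 2 * (s - 1 - l) + 2 * l - 2) = 1 by field_simp; ring,
    map_one, one_smul] at h4
  rw [h4]
  congr 3
  · split_ifs with h0
    · subst h0; push_cast; field_simp; ring
    · field_simp; ring
  · field_simp; ring

theorem compatOp_comp_auxOp (hd : 2 ≤ d) {D : Fin d → Module.End R M}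
    (hD : ∀ i j, Commute (D i) (D j)) {m : ℝ} (hm : m ≠ 0) {s : ℕ} (hs : 1 ≤ s) :
    compatOp D m s ∘ₗ auxOp D m s = LinearMap.id := by
  refine LinearMap.ext fun ψ => Subtype.ext ?_
  have hψ := ψ.2
  have hcoe : ((compatOp D m s ∘ₗ auxOp D m s) ψ).1 = divergence D (auxOp₁ D m s ψ).1
      - (kleinGordon D m).compLeft (Multiset (Fin d)) (auxOp₂ D m s ψ).1 := by
    simp [compatOp, auxOp, divergenceST_coe, kleinGordonST_coe, sub_eq_add_neg]
  -- `f l` is the mass term of the summand `l`. The `□` terms cancel by `e'`, and `e` identifies the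
  -- term with one more divergence as `-f (l + 1)`. At the ends, `f 0 = ψ` and `f s = 0`.
  set f : ℕ → Multiset (Fin d) → M := fun l =>
    algebraMap ℝ R (m ^ 2 * coeffB d s m (l + 1) * (1 / l.factorial)) •
      tracelessGradientPow D (s - 1) l ((divergence D ^ l) ψ.1) with hf
  have key : ∀ l ∈ Finset.range s,
      divergence D (algebraMap ℝ R (coeffA d s m (l + 1)) •
        algebraMap ℝ R (1 / (l + 1).factorial) •
          tracelessGradientPow D s (l + 1) ((divergence D ^ l) ψ.1))
      - (kleinGordon D m).compLeft (Multiset (Fin d)) (algebraMap ℝ R (coeffB d s m (l + 1)) •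
        algebraMap ℝ R (1 / l.factorial) •
          tracelessGradientPow D (s - 1) l ((divergence D ^ l) ψ.1)) = f l - f (l + 1) := by
    intro l hl
    rw [Finset.mem_range] at hl
    have hl1 : (l : ℝ) + 1 ≠ 0 := by positivity
    have hl2 : (l.factorial : ℝ) ≠ 0 := by positivity
    rw [map_smul, map_smul, map_smul, map_smul,
      divergence_tracelessGradientPow_divergence_pow hd hD hψ hl, kleinGordon_compLeft_apply]
    have e : algebraMap ℝ R (coeffA d s m (l + 1)) • algebraMap ℝ R (1 / (l + 1).factorial) •
        algebraMap ℝ R ((2 * (s : ℝ) + d - 4 - 2 * (l + 1)) / (2 * (s : ℝ) + d - 4)) •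
          tracelessGradientPow D (s - 1) (l + 1) ((divergence D ^ (l + 1)) ψ.1)
        = -f (l + 1) := by
      rcases Nat.lt_or_ge (l + 1) s with h' | h'
      · simp only [hf]
        rw [coeffB_add_two_eq hd hm h', ← neg_smul, ← map_neg]
        simp only [smul_smul, ← map_mul]
        congr 2
        ring
      · simp only [hf]
        rw [divergence_pow_eq_zero D hψ.1 (by omega)]
        simp
    have e' : ∀ W : Multiset (Fin d) → M,
        algebraMap ℝ R (coeffA d s m (l + 1)) • algebraMap ℝ R (1 / (l + 1).factorial) •
          algebraMap ℝ R ((l + 1) *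
            (if l = 0 then 1 else (2 * (s : ℝ) + d - 4 - l) / (2 * (s : ℝ) + d - 4))) • W
        = algebraMap ℝ R (coeffB d s m (l + 1)) • algebraMap ℝ R (1 / l.factorial) • W := by
      intro W
      simp only [smul_smul, ← map_mul]
      rw [coeffB_eq_coeffA, Nat.factorial_succ, Nat.cast_mul, Nat.cast_succ]
      congr 2
      field_simp
    have e'' : algebraMap ℝ R (coeffB d s m (l + 1)) • algebraMap ℝ R (1 / l.factorial) •
        algebraMap ℝ R (m ^ 2) • tracelessGradientPow D (s - 1) l ((divergence D ^ l) ψ.1)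
        = f l := by
      simp only [hf, smul_smul, ← map_mul]
      congr 2
      ring
    rw [smul_add, smul_add, smul_sub, smul_sub, e, e', e'']
    abel
  rw [hcoe, auxOp₁_coe, auxOp₂_coe, map_sum, map_sum, ← Finset.sum_sub_distrib,
    Finset.sum_congr rfl key, Finset.sum_range_sub']
  have h0 : f s = 0 := by
    simp only [hf]
    rw [divergence_pow_eq_zero D hψ.1 (by omega), map_zero, smul_zero]
  rw [h0, sub_zero]
  simp only [hf]
  rw [pow_zero, Module.End.one_apply, tracelessGradientPow_zero D hψ, zero_add, coeffB_one]
  simp [hm]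

theorem compatOp_comp_waveOp {D : Fin d → Module.End R M}
    (hD : ∀ i j, Commute (D i) (D j)) (m : ℝ) (s : ℕ) :
    compatOp D m s ∘ₗ waveOp D m s = 0 := by
  refine LinearMap.ext fun φ => Subtype.ext ?_
  have hcoe : ((compatOp D m s ∘ₗ waveOp D m s) φ).1
      = divergence D ((kleinGordon D m).compLeft (Multiset (Fin d)) φ.1)
      - (kleinGordon D m).compLeft (Multiset (Fin d)) (divergence D φ.1) := by
    simp [compatOp, waveOp, divergenceST_coe, kleinGordonST_coe, sub_eq_add_neg]
  rw [hcoe, compLeft_divergence (kleinGordon_commute hD m), sub_self]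
  rfl

theorem extendedOp_eq_zero_iff (hd : 2 ≤ d) {D : Fin d → Module.End R M}
    (hD : ∀ i j, Commute (D i) (D j)) {m : ℝ} (hm : m ≠ 0) {s : ℕ} (hs : 1 ≤ s)
    (φ : stTensor d R M s) (ψ : stTensor d R M (s - 1)) :
    extendedOp D m s (φ, ψ) = 0 ↔ waveOp D m s φ = 0 ∧ ψ = 0 := by
  have e : extendedOp D m s (φ, ψ) = waveOp D m s φ + auxOp D m s ψ := by simp [extendedOp]
  rw [e]
  constructor
  · intro h
    have h1 := congrArg (compatOp D m s) h
    have h2 := LinearMap.congr_fun (compatOp_comp_waveOp hD m s) φ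
    have h3 := LinearMap.congr_fun (compatOp_comp_auxOp hd hD hm hs) ψ
    simp only [LinearMap.comp_apply, LinearMap.zero_apply, LinearMap.id_apply] at h2 h3
    rw [map_add, h2, h3, zero_add, map_zero] at h1
    rw [h1, map_zero, add_zero] at h
    exact ⟨h, h1⟩
  · rintro ⟨h, rfl⟩
    rw [h, map_zero, add_zero]

end LeftInverse

/-! ### Partial derivatives commute -/

section Smooth

theorem partialDeriv_commute {d : ℕ} (Ω : TopologicalSpace.Opens (Fin d → ℝ)) (i j : Fin d) :
    Commute (partialDeriv Ω i) (partialDeriv Ω j) := by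
  refine LinearMap.ext fun f => Subtype.ext (funext fun x => ?_)
  by_cases hx : x ∈ Ω
  · have hf : ContDiffAt ℝ ∞ f.1 x := f.2.1.contDiffAt (Ω.isOpen.mem_nhds hx)
    have key : ∀ i j : Fin d, (partialDeriv Ω i (partialDeriv Ω j f)).1 x
        = fderiv ℝ (fderiv ℝ f.1) x (Pi.single i 1) (Pi.single j 1) := by
      intro i j
      -- The definition extends derivatives by zero outside `Ω`, so a second differentiation needs
      -- equality on a neighbourhood of `x`.
      have h1 : (partialDeriv Ω j f).1 =ᶠ[nhds x] fun y => fderiv ℝ f.1 y (Pi.single j 1) := by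
        filter_upwards [Ω.isOpen.mem_nhds hx] with y hy
        exact if_pos hy
      have h2 : DifferentiableAt ℝ (fderiv ℝ f.1) x :=
        (hf.fderiv_right (m := 1) (by norm_cast)).differentiableAt (by norm_num)
      have h3 : (partialDeriv Ω i (partialDeriv Ω j f)).1 x
          = fderiv ℝ (partialDeriv Ω j f).1 x (Pi.single i 1) := if_pos hx
      rw [h3, h1.fderiv_eq, fderiv_clm_apply h2 (differentiableAt_const _)]
      simp
    have hs : IsSymmSndFDerivAt ℝ f.1 x := hf.isSymmSndFDerivAt (by
      simpa using ENat.LEInfty.out)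
    exact (key i j).trans ((hs _ _).trans (key j i).symm)
  · exact (if_neg hx).trans (if_neg hx).symm

end Smooth

/-! ### Multisets of indices as index tuples -/

section OfFn

variable {d : ℕ}

theorem coe_ofFn_insertNth {k : ℕ} (a : Fin (k + 1)) (j : Fin d) (ν : Fin k → Fin d) :
    (List.ofFn (a.insertNth j ν : Fin (k + 1) → Fin d) : Multiset (Fin d))
      = j ::ₘ (List.ofFn ν : Multiset (Fin d)) := by
  rw [← Fin.univ_val_map, ← Fin.univ_val_map, Fin.univ_succAbove _ a, Finset.cons_val,
    Multiset.map_cons, Fin.insertNth_apply_same, Finset.map_val, Multiset.map_map]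
  congr 1
  refine Multiset.map_congr rfl fun x _ => ?_
  exact Fin.insertNth_apply_succAbove (α := fun _ => Fin d) a j ν x

theorem coe_ofFn_removeNth {k : ℕ} (a : Fin (k + 1)) (μ : Fin (k + 1) → Fin d) :
    (List.ofFn μ : Multiset (Fin d)) = μ a ::ₘ (List.ofFn (a.removeNth μ) : Multiset (Fin d)) := by
  rw [← coe_ofFn_insertNth a (μ a) (a.removeNth μ), Fin.insertNth_self_removeNth]

theorem coe_ofFn_surjective (s : Multiset (Fin d)) :
    ∃ μ : Fin s.card → Fin d, (List.ofFn μ : Multiset (Fin d)) = s := by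
  induction s using Quotient.inductionOn with
  | _ l => exact ⟨l.get, by simp⟩

/-- All positions carrying the index `i` contribute the same component, and their number is the
multiplicity in the definition. -/
theorem insertIdx_ofFn {R M : Type*} [CommRing R] [AddCommGroup M] [Module R M] {k : ℕ} (i : Fin d)
    (T : Multiset (Fin d) → M) (μ : Fin (k + 1) → Fin d) :
    insertIdx (R := R) i T (List.ofFn μ : Multiset (Fin d))
      = ∑ a, if μ a = i then T (List.ofFn (a.removeNth μ) : Multiset (Fin d)) else 0 := by
  have h : ∀ a : Fin (k + 1),
      (if μ a = i then T (List.ofFn (a.removeNth μ) : Multiset (Fin d)) else 0)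
      = if μ a = i then T ((List.ofFn μ : Multiset (Fin d)).erase i) else 0 := by
    intro a
    split_ifs with ha
    · rw [coe_ofFn_removeNth a μ, ha, Multiset.erase_cons_head]
    · rfl
  rw [Finset.sum_congr rfl fun a _ => h a, ← Finset.sum_filter, Finset.sum_const]
  change Multiset.count i _ • T _ = _
  congr 1
  rw [← Fin.univ_val_map, Multiset.count_map, Finset.card_def, Finset.filter_val]
  congr 2
  funext a
  exact propext eq_comm

theorem insertIdx_ofFn_zero {R M : Type*} [CommRing R] [AddCommGroup M] [Module R M] (i : Fin d)
    (T : Multiset (Fin d) → M) (μ : Fin 0 → Fin d) :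
    insertIdx (R := R) i T (List.ofFn μ : Multiset (Fin d)) = 0 := by
  simp [insertIdx]

theorem sum_insertNth {A : Type*} [AddCommMonoid A] {k : ℕ} (a : Fin (k + 1))
    (F : (Fin (k + 1) → Fin d) → A) :
    ∑ μ, F μ = ∑ ν : Fin k → Fin d, ∑ j : Fin d, F (a.insertNth j ν) := by
  rw [← (Fin.insertNthEquiv (fun _ => Fin d) a).sum_comp, Fintype.sum_prod_type_right]
  rfl

end OfFn

/-! ### Adjointness and nondegeneracy of the full contraction -/

section Contraction

variable {d : ℕ}

theorem contraction_comm (k : ℕ) (S T : Multiset (Fin d) → Poly d) :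
    contraction k S T = contraction k T S :=
  Finset.sum_congr rfl fun _ _ => by ring

/-- The full contraction as a bilinear form. -/
def contractionForm (d k : ℕ) : LinearMap.BilinForm (Poly d) (Multiset (Fin d) → Poly d) :=
  LinearMap.mk₂ (Poly d) (contraction k)
    (fun S S' T => by
      simp only [contraction, Pi.add_apply, mul_add, add_mul, Finset.sum_add_distrib])
    (fun c S T => by
      simp only [contraction, Pi.smul_apply, smul_eq_mul, Finset.mul_sum]
      exact Finset.sum_congr rfl fun _ _ => by ring)
    (fun S T T' => by
      simp only [contraction, Pi.add_apply, mul_add, Finset.sum_add_distrib])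
    (fun c S T => by
      simp only [contraction, Pi.smul_apply, smul_eq_mul, Finset.mul_sum]
      exact Finset.sum_congr rfl fun _ _ => by ring)

theorem contractionForm_apply (k : ℕ) (S T : Multiset (Fin d) → Poly d) :
    contractionForm d k S T = contraction k S T := rfl

theorem contractionForm_comm (k : ℕ) (S T : Multiset (Fin d) → Poly d) :
    contractionForm d k S T = contractionForm d k T S := contraction_comm k S T

/-- Each of the `k + 1` positions contributes equally, since `T` depends only on the multiset of its
indices. The adjunctions between gradient and divergence and between metric and trace follow by
linearity. -/
theorem contractionForm_insertIdx (k : ℕ) (i : Fin d) (S T : Multiset (Fin d) → Poly d) :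
    contractionForm d (k + 1) (insertIdx (R := Poly d) i S) T
      = ((k + 1 : ℕ) : Poly d) * (algebraMap ℝ (Poly d) (eta i) *
          contractionForm d k S (contract (R := Poly d) i T)) := by
  simp only [contractionForm_apply, contraction, insertIdx_ofFn, Finset.mul_sum, Finset.sum_mul]
  rw [Finset.sum_comm]
  have h : ∀ a : Fin (k + 1), (∑ μ : Fin (k + 1) → Fin d,
      (∏ j, algebraMap ℝ (Poly d) (eta (μ j))) *
        (if μ a = i then S (List.ofFn (a.removeNth μ) : Multiset (Fin d)) else 0) *
          T (List.ofFn μ : Multiset (Fin d)))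
      = ∑ ν : Fin k → Fin d, algebraMap ℝ (Poly d) (eta i) *
        ((∏ j, algebraMap ℝ (Poly d) (eta (ν j))) * S (List.ofFn ν : Multiset (Fin d)) *
          contract (R := Poly d) i T (List.ofFn ν : Multiset (Fin d))) := by
    intro a
    rw [sum_insertNth a]
    refine Finset.sum_congr rfl fun ν _ => ?_
    rw [Finset.sum_eq_single i]
    · rw [Fin.prod_univ_succAbove _ a, coe_ofFn_insertNth]
      simp only [Fin.insertNth_apply_same, Fin.insertNth_apply_succAbove, if_true,
        Fin.removeNth_insertNth]
      change _ * T _ = _ * (_ * T _)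
      ring
    · intro j _ hj
      simp [hj]
    · simp
  rw [Finset.sum_congr rfl fun a _ => h a, Finset.sum_const, Finset.card_univ, Fintype.card_fin,
    nsmul_eq_mul, Finset.mul_sum]

theorem momentum_compLeft (i : Fin d) (T : Multiset (Fin d) → Poly d) :
    (momentum i).compLeft (Multiset (Fin d)) T = (MvPolynomial.X i : Poly d) • T := rfl

theorem momentum_commute (i j : Fin d) : Commute (momentum i) (momentum j) :=
  LinearMap.ext fun f => mul_left_comm (MvPolynomial.X i) (MvPolynomial.X j) f

theorem contractionForm_gradient (k : ℕ) (S T : Multiset (Fin d) → Poly d) :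
    contractionForm d (k + 1) (gradient momentum S) T
      = ((k + 1 : ℕ) : Poly d) * contractionForm d k S (divergence momentum T) := by
  simp only [gradient_apply, divergence_apply, momentum_compLeft, map_sum, map_smul,
    LinearMap.sum_apply, LinearMap.smul_apply, contractionForm_insertIdx, smul_eq_mul,
    Finset.mul_sum]
  exact Finset.sum_congr rfl fun _ _ => by ring

theorem contractionForm_metricMul (k : ℕ) (S T : Multiset (Fin d) → Poly d) :
    contractionForm d (k + 2) (metricMul (R := Poly d) S) T
      = algebraMap ℝ (Poly d) (1 / 2) * ((k + 2 : ℕ) * (k + 1 : ℕ)) *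
        contractionForm d k S (trace (R := Poly d) T) := by
  simp only [metricMul_apply, trace_apply, map_sum, map_smul,
    LinearMap.sum_apply, LinearMap.smul_apply, contractionForm_insertIdx, smul_eq_mul,
    Finset.mul_sum]
  refine Finset.sum_congr rfl fun i _ => ?_
  linear_combination algebraMap ℝ (Poly d) (1 / 2) * ((k + 2 : ℕ) : Poly d) * ((k + 1 : ℕ) : Poly d)
    * algebraMap ℝ (Poly d) (eta i) * contractionForm d k S (contract (R := Poly d) i
      (contract (R := Poly d) i T)) * algebraMap_eta_mul_self (R := Poly d) i

/-- The discarded part is a multiple of the metric, and by adjunction it pairs with `T` through the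
trace of `T`. -/
theorem contractionForm_tracelessPart {k : ℕ} {S T : Multiset (Fin d) → Poly d}
    (hS : S ∈ symTensor d (Poly d) (Poly d) k) (hT : T ∈ polyST d k) :
    contractionForm d k (tracelessPart (R := Poly d) k S) T = contractionForm d k S T := by
  rcases lt_or_ge k 2 with hk | hk
  · rw [tracelessPart_of_trace_eq_zero k (trace_eq_zero hk hS)]
  rcases exists_sub_tracelessPart_eq hS with ⟨_, h⟩ | ⟨Θ, _, h⟩
  · rw [h]
  · obtain ⟨j, rfl⟩ := Nat.exists_eq_add_of_le' hk
    rw [eq_comm, ← sub_eq_zero, ← LinearMap.sub_apply, ← map_sub, h, contractionForm_metricMul,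
      (mem_stTensor.1 hT).2, map_zero, mul_zero]

theorem contractionForm_gradient_pow (k n : ℕ) : ∀ S T : Multiset (Fin d) → Poly d,
    (k.factorial : Poly d) * contractionForm d (k + n) ((gradient momentum ^ n) S) T
      = ((k + n).factorial : Poly d) * contractionForm d k S ((divergence momentum ^ n) T) := by
  induction n with
  | zero => intro S T; rfl
  | succ n ih =>
    intro S T
    rw [pow_succ' (gradient momentum), Module.End.mul_apply, ← add_assoc, contractionForm_gradient,
      mul_left_comm, ih, pow_succ (divergence momentum), Module.End.mul_apply, Nat.factorial_succ,
      Nat.cast_mul, mul_assoc]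

theorem contractionForm_gradDiv {k t n l : ℕ} (h : k - l + n = t) (h' : t - n + l = k)
    (S : polyST d k) (T : polyST d t) :
    ((n.factorial * k.factorial : ℕ) : Poly d) *
        contractionForm d t (gradDiv momentum k t n l h S).1 T.1
      = ((l.factorial * t.factorial : ℕ) : Poly d) *
        contractionForm d k S.1 (gradDiv momentum t k l n h' T).1 := by
  -- `j` is the rank between divergences and gradients. Together `h` and `h'` force `l ≤ k` and `n ≤
  -- t`, so nothing truncates.
  obtain ⟨j, hj⟩ : ∃ j, j = k - l := ⟨_, rfl⟩
  obtain rfl : j + n = t := by omega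
  obtain rfl : j + l = k := by omega
  have hS := divergence_pow_mem S.2.1 momentum l
  have hT := divergence_pow_mem T.2.1 momentum n
  rw [show j + l - l = j by omega] at hS
  rw [show j + n - n = j by omega] at hT
  have e : ∀ n : ℕ, (n.factorial : Poly d) * algebraMap ℝ (Poly d) (1 / n.factorial) = 1 := by
    intro n
    rw [← map_natCast (algebraMap ℝ (Poly d)), ← map_mul, mul_one_div_cancel (by positivity),
      map_one]
  have h1 := contractionForm_gradient_pow j n ((divergence momentum ^ l) S.1) T.1
  have h2 := contractionForm_gradient_pow j l ((divergence momentum ^ n) T.1) S.1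
  rw [contractionForm_comm j] at h2
  rw [gradDiv_coe, gradDiv_coe, map_smul, map_smul, LinearMap.smul_apply]
  simp only [tracelessGradientPow, Module.End.mul_apply, smul_eq_mul, Nat.cast_mul]
  rw [contractionForm_tracelessPart (gradient_pow_mem hS momentum n) T.2,
    contractionForm_comm (j + l) S.1,
    contractionForm_tracelessPart (gradient_pow_mem hT momentum l) S.2]
  have hj0 : (j.factorial : Poly d) ≠ 0 := Nat.cast_ne_zero.2 (by positivity)
  refine mul_left_cancel₀ hj0 ?_
  linear_combination ((j + l).factorial : Poly d) * h1 - ((j + n).factorial : Poly d) * h2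
    + (j.factorial : Poly d) * (j + l).factorial *
      contractionForm d (j + n) ((gradient momentum ^ n) ((divergence momentum ^ l) S.1)) T.1 * e n
    - (j.factorial : Poly d) * (j + n).factorial *
      contractionForm d (j + l) ((gradient momentum ^ l) ((divergence momentum ^ n) T.1)) S.1 * e l

/-- The pairing is `S t` times the number of orderings of `t` times a product of signs, and both
factors are nonzero in the polynomial ring. -/
theorem contractionForm_single (k : ℕ) (S : Multiset (Fin d) → Poly d) {t : Multiset (Fin d)}
    (ht : t.card = k) (h : contractionForm d k S (Pi.single t 1) = 0) : S t = 0 := by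
  subst ht
  have e : ∀ μ : Fin t.card → Fin d, (∏ i, algebraMap ℝ (Poly d) (eta (μ i))) *
      S (List.ofFn μ : Multiset (Fin d)) *
        (Pi.single t 1 : Multiset (Fin d) → Poly d) (List.ofFn μ : Multiset (Fin d))
      = if (List.ofFn μ : Multiset (Fin d)) = t then
        (t.map fun i => algebraMap ℝ (Poly d) (eta i)).prod * S t else 0 := by
    intro μ
    split_ifs with hμ
    · have : ∏ i, algebraMap ℝ (Poly d) (eta (μ i))
          = (t.map fun i => algebraMap ℝ (Poly d) (eta i)).prod := by
        refine Eq.trans ?_ (congrArg (fun u : Multiset (Fin d) =>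
          (u.map fun i => algebraMap ℝ (Poly d) (eta i)).prod) hμ)
        rw [← Fin.univ_val_map, Multiset.map_map]
        rfl
      rw [this, hμ, Pi.single_eq_same, mul_one]
    · rw [Pi.single_eq_of_ne hμ, mul_zero]
  rw [contractionForm_apply, contraction, Finset.sum_congr rfl fun μ _ => e μ, ← Finset.sum_filter,
    Finset.sum_const, nsmul_eq_mul] at h
  obtain ⟨μ, hμ⟩ := coe_ofFn_surjective t
  have hc : (Finset.univ.filter fun μ : Fin t.card → Fin d =>
      (List.ofFn μ : Multiset (Fin d)) = t).card ≠ 0 :=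
    Finset.card_ne_zero_of_mem (Finset.mem_filter.2 ⟨Finset.mem_univ μ, hμ⟩)
  have hp : (t.map fun i => algebraMap ℝ (Poly d) (eta i)).prod ≠ 0 := by
    rw [Ne, Multiset.prod_eq_zero_iff, Multiset.mem_map]
    rintro ⟨i, _, hi⟩
    have := algebraMap_eta_mul_self (R := Poly d) i
    rw [hi, mul_zero] at this
    exact zero_ne_one this
  rcases mul_eq_zero.1 h with h | h
  · exact absurd h (Nat.cast_ne_zero.2 hc)
  · exact (mul_eq_zero.1 h).resolve_left hp

theorem eq_zero_of_contractionForm {k : ℕ} (S : polyST d k)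
    (h : ∀ T : polyST d k, contractionForm d k S.1 T.1 = 0) : S = 0 := by
  refine Subtype.ext (funext fun t => ?_)
  by_cases ht : t.card = k
  · refine contractionForm_single k S.1 ht ?_
    have hm : (Pi.single t 1 : Multiset (Fin d) → Poly d) ∈ symTensor d (Poly d) (Poly d) k := by
      intro u hu
      rw [Pi.single_eq_of_ne]
      rintro rfl
      exact hu ht
    -- The indicator of `t` need not be traceless, but its traceless part has the same pairing with
    -- `S`.
    rw [contractionForm_comm, ← contractionForm_tracelessPart hm S.2, contractionForm_comm]
    exact h ⟨_, tracelessPart_mem hm⟩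
  · exact S.2.1 t ht

end Contraction

/-! ### The symbols as transposes, the left inverse `X`, and exactness -/

section Transpose

variable {d s : ℕ}

theorem contractionPair_eq (J K : polyST d s × polyST d (s - 1)) :
    contractionPair J K = contractionForm d s J.1.1 K.1.1
      + contractionForm d (s - 1) J.2.1 K.2.1 := rfl

theorem kleinGordonST_momentum_coe (m : ℝ) (k : ℕ) (T : polyST d k) :
    (kleinGordonST momentum m k T).1 = kleinGordon momentum m (1 : Poly d) • T.1 := by
  funext t
  change kleinGordon momentum m (T.1 t) = kleinGordon momentum m 1 * T.1 t
  rw [mul_comm, ← smul_eq_mul (T.1 t), ← map_smul, smul_eq_mul, mul_one]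

theorem kleinGordonST_momentum (m : ℝ) (k : ℕ) (T : polyST d k) :
    kleinGordonST momentum m k T = kleinGordon momentum m (1 : Poly d) • T :=
  Subtype.ext (kleinGordonST_momentum_coe m k T)

theorem kleinGordon_momentum_one_ne_zero {m : ℝ} (hm : m ≠ 0) :
    kleinGordon momentum m (1 : Poly d) ≠ 0 := by
  intro h
  have h1 := congrArg (MvPolynomial.aeval (fun _ : Fin d => (0 : ℝ))) h
  simp [kleinGordon, momentum] at h1
  exact hm h1

theorem contractionForm_gradDiv_one (hs : 1 ≤ s) (Y : polyST d (s - 1)) (φ : polyST d s) :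
    contractionForm d s
        (algebraMap ℝ (Poly d) (1 / s) • gradDiv momentum (s - 1) s 1 0 (by omega) Y).1 φ.1
      = contractionForm d (s - 1) Y.1 (divergence momentum φ.1) := by
  have h := contractionForm_gradDiv (k := s - 1) (t := s) (n := 1) (l := 0) (by omega) (by omega)
    Y φ
  have e : (gradDiv momentum s (s - 1) 0 1 (by omega) φ).1 = divergence momentum φ.1 := by
    rw [gradDiv_coe, tracelessGradientPow_zero momentum
      (divergence_pow_mem_stTensor φ.2 momentum 1)]
    simp
  rw [e, ← Nat.mul_factorial_pred (by omega : s ≠ 0)] at h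
  simp only [Nat.factorial_one, Nat.factorial_zero, one_mul, Nat.cast_mul] at h
  have hr : ((s - 1).factorial : Poly d) ≠ 0 := Nat.cast_ne_zero.2 (by positivity)
  have e1 : algebraMap ℝ (Poly d) (1 / s) * (s : Poly d) = 1 := by
    rw [← map_natCast (algebraMap ℝ (Poly d)), ← map_mul, one_div_mul_cancel (by positivity),
      map_one]
  have hc : (algebraMap ℝ (Poly d) (1 / s) • gradDiv momentum (s - 1) s 1 0 (by omega) Y).1
      = algebraMap ℝ (Poly d) (1 / s) •
        (gradDiv momentum (s - 1) s 1 0 (by omega) Y).1 := rfl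
  rw [hc, map_smul, LinearMap.smul_apply, smul_eq_mul]
  refine mul_left_cancel₀ hr ?_
  linear_combination algebraMap ℝ (Poly d) (1 / s) * h + ((s - 1).factorial : Poly d) *
    contractionForm d (s - 1) Y.1 (divergence momentum φ.1) * e1

/-- The factor `s/(l+1)` is the quotient of factorials in `contractionForm_gradDiv`; it becomes the
weight in the first block of `symbolX`. The second block of `X̂` is its own transpose. -/
theorem contractionForm_gradDiv_symbolX {l : ℕ} (hl : l < s) (J : polyST d s)
    (ψ : polyST d (s - 1)) :
    algebraMap ℝ (Poly d) (s / (l + 1)) *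
        contractionForm d (s - 1) (gradDiv momentum s (s - 1) l (l + 1) (by omega) J).1 ψ.1
      = contractionForm d s J.1 (gradDiv momentum (s - 1) s (l + 1) l (by omega) ψ).1 := by
  have h := contractionForm_gradDiv (k := s) (t := s - 1) (n := l) (l := l + 1)
    (by omega) (by omega) J ψ
  rw [← Nat.mul_factorial_pred (by omega : s ≠ 0), Nat.factorial_succ] at h
  have hr : ((l.factorial * (s - 1).factorial : ℕ) : Poly d) ≠ 0 :=
    Nat.cast_ne_zero.2 (by positivity)
  have e : ((l + 1 : ℕ) : Poly d) * algebraMap ℝ (Poly d) (s / (l + 1)) = (s : Poly d) := by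
    rw [← map_natCast (algebraMap ℝ (Poly d)), ← map_mul, ← map_natCast (algebraMap ℝ (Poly d)),
      Nat.cast_add_one, mul_div_cancel₀ _ (by positivity)]
  have hl : ((l + 1 : ℕ) : Poly d) ≠ 0 := Nat.cast_ne_zero.2 (by omega)
  simp only [Nat.cast_mul] at h hr
  refine mul_left_cancel₀ hl (mul_left_cancel₀ hr ?_)
  linear_combination h + (l.factorial : Poly d) * ((s - 1).factorial : Poly d) *
    contractionForm d (s - 1) (gradDiv momentum s (s - 1) l (l + 1) (by omega) J).1 ψ.1 * e

theorem contraction_symbolA (m : ℝ) (hs : 1 ≤ s) (J : polyST d s × polyST d (s - 1))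
    (φ : polyST d s) :
    contraction s (symbolA d s m hs J).1 φ.1 = contractionPair J (waveOp momentum m s φ) := by
  have h1 : (symbolA d s m hs J).1 = (kleinGordonST momentum m s J.1).1
      + (algebraMap ℝ (Poly d) (1 / s) • gradDiv momentum (s - 1) s 1 0 (by omega) J.2).1 := rfl
  have h2 : (waveOp momentum m s φ).1.1 = (kleinGordonST momentum m s φ).1 := rfl
  have h3 : (waveOp momentum m s φ).2.1 = divergence momentum φ.1 := rfl
  rw [contractionPair_eq, h2, h3, ← contractionForm_apply, h1, map_add, LinearMap.add_apply,
    contractionForm_gradDiv_one hs, kleinGordonST_momentum_coe, kleinGordonST_momentum_coe, map_smul,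
    map_smul, LinearMap.smul_apply]

theorem contractionPair_symbolA₁ (m : ℝ) (hs : 1 ≤ s) (Y : polyST d (s - 1))
    (J : polyST d s × polyST d (s - 1)) :
    contractionPair (symbolA₁ d s m hs Y) J
      = contraction (s - 1) Y.1 (compatOp momentum m s J).1 := by
  have h1 : (symbolA₁ d s m hs Y).1
      = algebraMap ℝ (Poly d) (1 / s) • gradDiv momentum (s - 1) s 1 0 (by omega) Y := rfl
  have h2 : (symbolA₁ d s m hs Y).2.1 = -(kleinGordonST momentum m (s - 1) Y).1 := rfl
  have h3 : (compatOp momentum m s J).1 = divergence momentum J.1.1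
      + -(kleinGordonST momentum m (s - 1) J.2).1 := rfl
  rw [contractionPair_eq, h1, h2, h3, ← contractionForm_apply, map_add,
    contractionForm_gradDiv_one hs, kleinGordonST_momentum_coe, kleinGordonST_momentum_coe, map_neg,
    map_neg, map_smul, map_smul, LinearMap.neg_apply, LinearMap.smul_apply]

/-- The transpose of the operator `X̂`, acting on columns. -/
def symbolX (d s : ℕ) (m : ℝ) :
    polyST d s × polyST d (s - 1) →ₗ[Poly d] polyST d (s - 1) :=
  (∑ l : Fin s, algebraMap ℝ (Poly d) (coeffA d s m (l + 1) * (s / (l + 1))) •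
    gradDiv momentum s (s - 1) l (l + 1) (by have := l.2; omega)).coprod (auxOp₂ momentum m s)

theorem symbolX_coe (m : ℝ) (J : polyST d s × polyST d (s - 1)) :
    (symbolX d s m J).1 = (∑ l : Fin s, algebraMap ℝ (Poly d) (coeffA d s m (l + 1) *
      (s / (l + 1))) • (gradDiv momentum s (s - 1) l (l + 1) (by have := l.2; omega) J.1).1)
      + (auxOp₂ momentum m s J.2).1 := by
  rw [symbolX, LinearMap.coprod_apply, LinearMap.sum_apply, Submodule.coe_add,
    AddSubmonoidClass.coe_finsetSum]
  rfl

theorem auxOp₁_coe' (m : ℝ) (ψ : polyST d (s - 1)) :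
    (auxOp₁ momentum m s ψ).1 = ∑ l : Fin s, algebraMap ℝ (Poly d) (coeffA d s m (l + 1)) •
      (gradDiv momentum (s - 1) s (l + 1) l (by have := l.2; omega) ψ).1 := by
  rw [auxOp₁, LinearMap.sum_apply, AddSubmonoidClass.coe_finsetSum]
  rfl

theorem auxOp₂_coe' (m : ℝ) (ψ : polyST d (s - 1)) :
    (auxOp₂ momentum m s ψ).1 = ∑ l : Fin s, algebraMap ℝ (Poly d) (coeffB d s m (l + 1)) •
      (gradDiv momentum (s - 1) (s - 1) l l (by have := l.2; omega) ψ).1 := by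
  rw [auxOp₂, LinearMap.sum_apply, AddSubmonoidClass.coe_finsetSum]
  rfl

theorem contraction_symbolX (m : ℝ) (J : polyST d s × polyST d (s - 1)) (ψ : polyST d (s - 1)) :
    contraction (s - 1) (symbolX d s m J).1 ψ.1
      = contractionPair J (auxOp momentum m s ψ) := by
  have h1 : (auxOp momentum m s ψ).1.1 = (auxOp₁ momentum m s ψ).1 := rfl
  have h2 : (auxOp momentum m s ψ).2.1 = (auxOp₂ momentum m s ψ).1 := rfl
  rw [contractionPair_eq, h1, h2, ← contractionForm_apply, symbolX_coe, auxOp₁_coe', auxOp₂_coe',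
    auxOp₂_coe', map_add, LinearMap.add_apply]
  simp only [map_sum, map_smul, LinearMap.sum_apply, LinearMap.smul_apply, smul_eq_mul]
  refine congrArg₂ (· + ·) (Finset.sum_congr rfl fun l _ => ?_)
    (Finset.sum_congr rfl fun l _ => ?_)
  · rw [map_mul, mul_assoc, contractionForm_gradDiv_symbolX l.2]
  · have h := contractionForm_gradDiv (k := s - 1) (t := s - 1) (n := l) (l := l)
      (by have := l.2; omega) (by have := l.2; omega) J.2 ψ
    have hc : (((l : ℕ).factorial * (s - 1).factorial : ℕ) : Poly d) ≠ 0 :=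
      Nat.cast_ne_zero.2 (by positivity)
    rw [mul_left_cancel₀ hc h]

theorem symbolX_comp_symbolA₁ (hd : 2 ≤ d) {m : ℝ} (hm : m ≠ 0) (hs : 1 ≤ s) :
    symbolX d s m ∘ₗ symbolA₁ d s m hs = LinearMap.id := by
  refine LinearMap.ext fun Y => sub_eq_zero.1 (eq_zero_of_contractionForm _ fun ψ => ?_)
  have h := LinearMap.congr_fun (compatOp_comp_auxOp hd momentum_commute hm hs) ψ
  have h1 : contractionForm d (s - 1) (symbolX d s m (symbolA₁ d s m hs Y)).1 ψ.1
      = contractionForm d (s - 1) Y.1 ψ.1 := by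
    rw [contractionForm_apply, contraction_symbolX, contractionPair_symbolA₁]
    exact congrArg (fun T : polyST d (s - 1) => contraction (s - 1) Y.1 T.1) h
  change contractionForm d (s - 1) ((symbolX d s m (symbolA₁ d s m hs Y)).1 - Y.1) ψ.1 = 0
  rw [map_sub, LinearMap.sub_apply, h1, sub_self]

theorem symbolA_comp_symbolA₁ (m : ℝ) (hs : 1 ≤ s) :
    symbolA d s m hs ∘ₗ symbolA₁ d s m hs = 0 := by
  refine LinearMap.ext fun Y => ?_
  set G : polyST d (s - 1) →ₗ[Poly d] polyST d s := gradDiv momentum (s - 1) s 1 0 (by omega)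
  change kleinGordonST momentum m s (algebraMap ℝ (Poly d) (1 / s) • G Y)
    + algebraMap ℝ (Poly d) (1 / s) • G (-kleinGordonST momentum m (s - 1) Y) = 0
  rw [kleinGordonST_momentum, kleinGordonST_momentum, map_neg, map_smul, smul_neg, smul_comm,
    add_neg_cancel]

theorem exact_symbolA₁_symbolA (hd : 2 ≤ d) {m : ℝ} (hm : m ≠ 0) (hs : 1 ≤ s) :
    Function.Exact (symbolA₁ d s m hs) (symbolA d s m hs) := by
  have hcomp := symbolA_comp_symbolA₁ (d := d) m hs
  refine fun J => ⟨fun hJ => ⟨symbolX d s m J, ?_⟩, ?_⟩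
  · set κ : Poly d := kleinGordon momentum m 1 with hκ
    have hκ0 : κ ≠ 0 := kleinGordon_momentum_one_ne_zero hm
    have hX := LinearMap.congr_fun (symbolX_comp_symbolA₁ hd hm hs) J.2
    have hJ' : κ • J.1 + algebraMap ℝ (Poly d) (1 / s) •
        gradDiv momentum (s - 1) s 1 0 (by omega) J.2 = 0 := by
      rw [← kleinGordonST_momentum]
      exact hJ
    -- The first component is `AJ = 0` rearranged, the second is the definition of `A₁`. Applying
    -- `X` shows that `J''` is divisible by `κ`, with quotient `-XJ`.
    have hA : symbolA₁ d s m hs J.2 = -(κ • J) := by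
      refine Prod.ext ?_ ?_
      · exact eq_neg_of_add_eq_zero_right hJ'
      · change -(kleinGordonST momentum m (s - 1) J.2) = -(κ • J.2)
        rw [kleinGordonST_momentum]
    have h3 : J.2 = -(κ • symbolX d s m J) := by
      rw [LinearMap.comp_apply, hA, map_neg, map_smul] at hX
      exact hX.symm
    have h4 : κ • symbolA₁ d s m hs (symbolX d s m J) = κ • J := by
      rw [← map_smul, ← neg_inj, ← map_neg, ← h3, hA]
    exact smul_right_injective _ hκ0 h4
  · rintro ⟨Y, rfl⟩
    exact LinearMap.congr_fun hcomp Y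

end Transpose

/-! ### Kernel and cokernel of the square matrix `(X; A)` -/

section Algebra

variable {P F₂ F₁ F₀ : Type*} [CommRing P] [AddCommGroup F₂] [Module P F₂]
  [AddCommGroup F₁] [Module P F₁] [AddCommGroup F₀] [Module P F₀]

theorem injective_of_leftInverse {A₁ : F₂ →ₗ[P] F₁} {X : F₁ →ₗ[P] F₂}
    (hX : X ∘ₗ A₁ = LinearMap.id) : Function.Injective A₁ :=
  Function.LeftInverse.injective fun y => LinearMap.congr_fun hX y

theorem ker_prod_eq_bot {A₁ : F₂ →ₗ[P] F₁} {A : F₁ →ₗ[P] F₀} {X : F₁ →ₗ[P] F₂}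
    (hX : X ∘ₗ A₁ = LinearMap.id) (hA : Function.Exact A₁ A) :
    LinearMap.ker (X.prod A) = ⊥ := by
  refine LinearMap.ker_eq_bot'.2 fun J hJ => ?_
  obtain ⟨Y, rfl⟩ := (hA J).1 (congrArg Prod.snd hJ)
  have h1 : X (A₁ Y) = 0 := congrArg Prod.fst hJ
  have h2 := LinearMap.congr_fun hX Y
  rw [LinearMap.comp_apply, h1] at h2
  rw [show Y = 0 from h2.symm, map_zero]

theorem nonempty_coker_prod_equiv {A₁ : F₂ →ₗ[P] F₁} {A : F₁ →ₗ[P] F₀} {X : F₁ →ₗ[P] F₂}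
    (hX : X ∘ₗ A₁ = LinearMap.id) (hA : Function.Exact A₁ A) :
    Nonempty ((F₀ ⧸ LinearMap.range A) ≃ₗ[P] ((F₂ × F₀) ⧸ LinearMap.range (X.prod A))) := by
  set π : F₂ × F₀ →ₗ[P] F₀ ⧸ LinearMap.range A :=
    (LinearMap.range A).mkQ ∘ₗ LinearMap.snd P F₂ F₀ with hπ
  have hsurj : Function.Surjective π :=
    (Submodule.mkQ_surjective _).comp LinearMap.snd_surjective
  have hker : LinearMap.ker π = LinearMap.range (X.prod A) := by
    ext ⟨Y, Z⟩
    rw [LinearMap.mem_ker, hπ, LinearMap.comp_apply, LinearMap.snd_apply, Submodule.mkQ_apply,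
      Submodule.Quotient.mk_eq_zero]
    constructor
    · rintro ⟨J, rfl⟩
      -- Adding an element of the range of `A₁` leaves `AJ` unchanged, while `XA₁ = 1` allows any
      -- value of the `X` component.
      refine ⟨J + A₁ (Y - X J), Prod.ext ?_ ?_⟩
      · change X (J + A₁ (Y - X J)) = Y
        have := LinearMap.congr_fun hX (Y - X J)
        rw [LinearMap.comp_apply] at this
        rw [map_add, this, LinearMap.id_apply, add_sub_cancel]
      · change A (J + A₁ (Y - X J)) = A J
        rw [map_add, hA.apply_apply_eq_zero, add_zero]
    · rintro ⟨J, hJ⟩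
      exact ⟨J, congrArg Prod.snd hJ⟩
  exact ⟨(π.quotKerEquivOfSurjective hsurj).symm.trans (Submodule.quotEquivOfEq _ _ hker)⟩

end Algebra

/-! ### Freeness and co-flatness -/

section Free

/-- Symmetric traceless polynomial tensors are polynomial combinations of a basis of the
symmetric traceless real tensors. -/
theorem exists_polyST_equiv (d k : ℕ) :
    ∃ n : ℕ, Nonempty (polyST d k ≃ₗ[Poly d] (Fin n → Poly d)) := by
  set W := stTensor d ℝ ℝ k
  let r : W →ₗ[ℝ] (Sym (Fin d) k → ℝ) :=
    { toFun := fun T s => T.1 s.1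
      map_add' := fun _ _ => rfl
      map_smul' := fun _ _ => rfl }
  have hr : LinearMap.ker r = ⊥ := by
    refine LinearMap.ker_eq_bot'.2 fun T hT => Subtype.ext (funext fun s => ?_)
    by_cases hs : s.card = k
    · exact congrFun hT ⟨s, hs⟩
    · exact T.2.1 s hs
  have : Module.Finite ℝ W := Module.Finite.of_injective r (LinearMap.ker_eq_bot.1 hr)
  obtain ⟨g, hg⟩ := r.exists_leftInverse_of_injective hr
  let b := Module.finBasis ℝ W
  -- The left inverse `g` extends the coordinate functionals of `b` to all component vectors. The
  -- resulting real matrix `c` also gives coordinates of polynomial tensors.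
  let c : Fin (Module.finrank ℝ W) → Sym (Fin d) k → ℝ := fun j t => b.repr (g (Pi.single t 1)) j
  have hc : ∀ (T : W) j, b.repr T j = ∑ t, c j t * T.1 t.1 := by
    intro T j
    have h1 : T = g (r T) := (LinearMap.congr_fun hg T).symm
    have h2 : r T = ∑ t, T.1 t.1 • (Pi.single t 1 : Sym (Fin d) k → ℝ) := by
      funext u
      simp [r, Finset.sum_apply, Pi.single_apply]
    conv_lhs => rw [h1, h2, map_sum, map_sum, Finsupp.finsetSum_apply]
    refine Finset.sum_congr rfl fun t _ => ?_
    rw [map_smul, map_smul, Finsupp.smul_apply, smul_eq_mul, mul_comm]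
  -- The trace has real coefficients, so it acts on each monomial coefficient separately; the
  -- expansion in `b` can be checked monomial by monomial.
  have hcoeff : ∀ (T : polyST d k) (ν : Fin d →₀ ℕ), (fun s => (T.1 s).coeff ν) ∈ W := by
    intro T ν
    refine ⟨fun s hs => ?_, funext fun s => ?_⟩
    · change (T.1 s).coeff ν = 0
      rw [T.2.1 s hs, MvPolynomial.coeff_zero]
    · have h := congrArg (MvPolynomial.coeff ν) (congrFun T.2.2 s)
      simpa [trace, contract, MvPolynomial.coeff_sum, MvPolynomial.algebraMap_eq,
        MvPolynomial.coeff_C_mul] using h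
  have hbmem : ∀ j, (fun s => MvPolynomial.C ((b j).1 s) : Multiset (Fin d) → Poly d)
      ∈ polyST d k := by
    intro j
    refine ⟨fun s hs => ?_, funext fun s => ?_⟩
    · change MvPolynomial.C ((b j).1 s) = 0
      rw [(b j).2.1 s hs, map_zero]
    · have h := congrArg (MvPolynomial.C (σ := Fin d)) (congrFun (b j).2.2 s)
      simpa [trace, contract, MvPolynomial.algebraMap_eq] using h
  refine ⟨Module.finrank ℝ W, ⟨LinearEquiv.ofLinearMap (M₂ := Fin (Module.finrank ℝ W) → Poly d)
    { toFun := fun T j => ∑ t : Sym (Fin d) k, MvPolynomial.C (c j t) * T.1 t.1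
      map_add' := fun T U => funext fun j => by
        simp [mul_add, Finset.sum_add_distrib]
      map_smul' := fun p T => funext fun j => by
        simp [Finset.mul_sum, mul_left_comm] }
    (Fintype.linearCombination (Poly d) fun j => (⟨_, hbmem j⟩ : polyST d k)) ?_ ?_⟩⟩
  · refine LinearMap.ext fun p => funext fun j => ?_
    have h1 : ∀ i, ∑ t : Sym (Fin d) k, MvPolynomial.C (c j t) * MvPolynomial.C ((b i).1 t.1)
        = (MvPolynomial.C (if i = j then 1 else 0) : Poly d) := by
      intro i
      have := hc (b i) j
      rw [b.repr_self, Finsupp.single_apply] at this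
      rw [this, map_sum]
      simp
    simp only [LinearMap.comp_apply, LinearMap.coe_mk, AddHom.coe_mk,
      Fintype.linearCombination_apply, AddSubmonoidClass.coe_finsetSum, Submodule.coe_smul,
      Finset.sum_apply, Pi.smul_apply, smul_eq_mul, Finset.mul_sum, LinearMap.id_apply]
    rw [Finset.sum_comm]
    simp only [mul_left_comm _ (p _), ← Finset.mul_sum, h1]
    simp
  · refine LinearMap.ext fun T => Subtype.ext (funext fun s => MvPolynomial.ext _ _ fun ν => ?_)
    have h1 := congrArg (fun U : W => U.1 s) (b.sum_repr ⟨_, hcoeff T ν⟩)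
    simp only [hc, AddSubmonoidClass.coe_finsetSum, Finset.sum_apply, Submodule.coe_smul,
      Pi.smul_apply, smul_eq_mul] at h1
    rw [LinearMap.id_apply, ← h1]
    simp only [LinearMap.comp_apply, LinearMap.coe_mk, AddHom.coe_mk,
      Fintype.linearCombination_apply, AddSubmonoidClass.coe_finsetSum, Submodule.coe_smul,
      Finset.sum_apply, Pi.smul_apply, smul_eq_mul, MvPolynomial.coeff_sum]
    refine Finset.sum_congr rfl fun j _ => ?_
    rw [mul_comm, MvPolynomial.coeff_C_mul, MvPolynomial.coeff_sum, mul_comm]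
    simp only [MvPolynomial.coeff_C_mul]

theorem polyST_free_finite (d k : ℕ) :
    Module.Free (Poly d) (polyST d k) ∧ Module.Finite (Poly d) (polyST d k) := by
  obtain ⟨n, ⟨e⟩⟩ := exists_polyST_equiv d k
  exact ⟨Module.Free.of_equiv e.symm, Module.Finite.equiv e.symm⟩

theorem isOneStepResolution_symbolA {d s : ℕ} (hd : 2 ≤ d) {m : ℝ} (hm : m ≠ 0) (hs : 1 ≤ s) :
    IsOneStepResolution (symbolA₁ d s m hs) (symbolA d s m hs) := by
  obtain ⟨_, _⟩ := polyST_free_finite d s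
  obtain ⟨_, _⟩ := polyST_free_finite d (s - 1)
  exact ⟨⟨inferInstance, inferInstance⟩, ⟨inferInstance, inferInstance⟩,
    ⟨inferInstance, inferInstance⟩, injective_of_leftInverse (symbolX_comp_symbolA₁ hd hm hs),
    exact_symbolA₁_symbolA hd hm hs⟩

theorem isCoFlat_symbolA {d s : ℕ} (hd : 2 ≤ d) {m : ℝ} (hm : m ≠ 0) (hs : 1 ≤ s) :
    IsCoFlat (symbolA d s m hs) := by
  obtain ⟨_, hF₁, hF₀, hinj, hex⟩ := isOneStepResolution_symbolA hd hm hs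
  obtain ⟨n, ⟨e⟩⟩ := exists_polyST_equiv d (s - 1)
  refine ⟨n, symbolA₁ d s m hs ∘ₗ e.symm.toLinearMap,
    ⟨⟨inferInstance, inferInstance⟩, hF₁, hF₀, hinj.comp e.symm.injective, ?_⟩,
    Or.inl ⟨e.toLinearMap ∘ₗ symbolX d s m, ?_⟩⟩
  · intro J
    rw [hex J]
    exact (e.symm.surjective.range_comp (symbolA₁ d s m hs)).symm ▸ Iff.rfl
  · refine LinearMap.ext fun p => ?_
    have := LinearMap.congr_fun (symbolX_comp_symbolA₁ hd hm hs) (e.symm p)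
    rw [LinearMap.comp_apply] at this
    simp only [LinearMap.comp_apply, LinearEquiv.coe_coe, this, LinearMap.id_apply,
      LinearEquiv.apply_symm_apply]

end Free

/-! ### Lorentz invariance -/

section Lorentz

variable {d : ℕ} {L : Matrix (Fin d) (Fin d) ℝ} {T K : Multiset (Fin d) → Poly d}

theorem diagonal_eta_mul_self :
    (Matrix.diagonal eta * Matrix.diagonal eta : Matrix (Fin d) (Fin d) ℝ) = 1 := by
  rw [Matrix.diagonal_mul_diagonal, ← Matrix.diagonal_one]
  congr 1
  funext i
  exact eta_mul_self i

theorem IsLorentz.inv_eq (hL : IsLorentz L) :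
    L⁻¹ = Matrix.diagonal eta * L.transpose * Matrix.diagonal eta := by
  refine Matrix.inv_eq_left_inv ?_
  rw [Matrix.mul_assoc, Matrix.mul_assoc, ← Matrix.mul_assoc L.transpose, hL,
    diagonal_eta_mul_self]

theorem IsLorentz.inv_mul (hL : IsLorentz L) : L⁻¹ * L = 1 := by
  rw [hL.inv_eq, Matrix.mul_assoc, Matrix.mul_assoc, ← Matrix.mul_assoc L.transpose, hL,
    diagonal_eta_mul_self]

theorem IsLorentz.mul_inv (hL : IsLorentz L) : L * L⁻¹ = 1 :=
  mul_eq_one_comm.1 hL.inv_mul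

theorem IsLorentz.sum_eta (hL : IsLorentz L) (l j : Fin d) :
    ∑ i, eta i * L i l * L i j = if l = j then eta l else 0 := by
  have h := congrFun (congrFun hL l) j
  rw [Matrix.mul_apply] at h
  simp only [Matrix.mul_diagonal, Matrix.transpose_apply, Matrix.diagonal_apply] at h
  rw [← h]
  exact Finset.sum_congr rfl fun _ _ => by ring

theorem IsLorentz.sum_eta_inv (hL : IsLorentz L) (l j : Fin d) :
    ∑ i, eta i * L⁻¹ l i * L⁻¹ j i = if l = j then eta l else 0 := by
  have h : L⁻¹ * Matrix.diagonal eta * L⁻¹.transpose = Matrix.diagonal eta := by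
    have h1 : L⁻¹ * Matrix.diagonal eta = Matrix.diagonal eta * L.transpose := by
      rw [hL.inv_eq, Matrix.mul_assoc, diagonal_eta_mul_self, Matrix.mul_one]
    rw [h1, Matrix.mul_assoc, ← Matrix.transpose_mul, hL.inv_mul, Matrix.transpose_one,
      Matrix.mul_one]
  have h := congrFun (congrFun h l) j
  rw [Matrix.mul_apply] at h
  simp only [Matrix.mul_diagonal, Matrix.transpose_apply, Matrix.diagonal_apply] at h
  rw [← h]
  exact Finset.sum_congr rfl fun _ _ => by ring

/-- The factor `1` stands for the weight `w i` in `sum_smul_sum_smul`. -/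
theorem IsLorentz.sum_inv (hL : IsLorentz L) (l j : Fin d) :
    ∑ i, 1 * L i l * L⁻¹ j i = if l = j then 1 else 0 := by
  have h := congrFun (congrFun hL.inv_mul j) l
  rw [Matrix.mul_apply, Matrix.one_apply] at h
  simp only [eq_comm (a := l), ← h]
  exact Finset.sum_congr rfl fun _ _ => by ring

/-- Common form of the invariance of a contracted index pair: it covers `η` (trace, divergence), the
inverse transformation of `η` (metric product) and the Kronecker delta (gradient). -/
theorem sum_smul_sum_smul {P V : Type*} [CommRing P] [Algebra ℝ P] [AddCommGroup V] [Module P V]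
    {w w' : Fin d → ℝ} {A B : Fin d → Fin d → ℝ}
    (h : ∀ l j, ∑ i, w i * A i l * B i j = if l = j then w' l else 0) (f : Fin d → Fin d → V) :
    ∑ i, algebraMap ℝ P (w i) • ∑ l, algebraMap ℝ P (A i l) • ∑ j, algebraMap ℝ P (B i j) • f l j
      = ∑ l, algebraMap ℝ P (w' l) • f l l := by
  simp only [Finset.smul_sum, smul_smul, ← map_mul]
  rw [Finset.sum_comm]
  refine Finset.sum_congr rfl fun l _ => ?_
  rw [Finset.sum_comm, Finset.sum_eq_single l]
  · rw [← Finset.sum_smul, ← map_sum]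
    congr 2
    rw [← (h l l).trans (if_pos rfl)]
    exact Finset.sum_congr rfl fun _ _ => by ring
  · intro j _ hj
    rw [← Finset.sum_smul, ← map_sum,
      show ∑ i, w i * (A i l * B i j) = 0 by
        rw [← (h l j).trans (if_neg (Ne.symm hj))]
        exact Finset.sum_congr rfl fun _ _ => by ring,
      map_zero, zero_smul]
  · simp

/-- The substitution `p ↦ L⁻¹ p`. -/
def lorentzSubst (L : Matrix (Fin d) (Fin d) ℝ) : Poly d →ₐ[ℝ] Poly d :=
  MvPolynomial.aeval fun i => ∑ j, algebraMap ℝ (Poly d) (L⁻¹ i j) * MvPolynomial.X j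

theorem isLorentzTransform_iff : IsLorentzTransform L T K ↔
    ∀ (k : ℕ) (μ : Fin k → Fin d), K (List.ofFn μ : Multiset (Fin d)) =
      ∑ ν : Fin k → Fin d, (∏ i, algebraMap ℝ (Poly d) (L (μ i) (ν i))) *
        lorentzSubst L (T (List.ofFn ν : Multiset (Fin d))) := Iff.rfl

/-- Evaluating `(Lp)_i` at `L⁻¹p` returns `p_i`, so the momentum transforms with `L`, like a tensor
index. -/
theorem lorentzSubst_sum_X (hL : IsLorentz L) (i : Fin d) :
    lorentzSubst L (∑ j, algebraMap ℝ (Poly d) (L i j) • MvPolynomial.X j)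
      = MvPolynomial.X i := by
  have h : ∀ l, ∑ j, algebraMap ℝ (Poly d) (L i j) * algebraMap ℝ (Poly d) (L⁻¹ j l)
      = if i = l then 1 else 0 := by
    intro l
    have := congrFun (congrFun hL.mul_inv i) l
    rw [Matrix.mul_apply, Matrix.one_apply] at this
    simp only [← map_mul]
    rw [← map_sum, this]
    split_ifs <;> simp
  simp only [smul_eq_mul, map_sum, map_mul, AlgHom.commutes]
  simp only [lorentzSubst, MvPolynomial.aeval_X, Finset.mul_sum]
  rw [Finset.sum_comm]
  simp only [← mul_assoc, ← Finset.sum_mul, h]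
  simp

theorem IsLorentzTransform.add {T' K' : Multiset (Fin d) → Poly d}
    (h : IsLorentzTransform L T K) (h' : IsLorentzTransform L T' K') :
    IsLorentzTransform L (T + T') (K + K') := by
  rw [isLorentzTransform_iff] at *
  intro k μ
  simp only [Pi.add_apply, h k μ, h' k μ, map_add, mul_add, Finset.sum_add_distrib]

theorem IsLorentzTransform.smul (h : IsLorentzTransform L T K) (q : Poly d) :
    IsLorentzTransform L (q • T) (lorentzSubst L q • K) := by
  rw [isLorentzTransform_iff] at *
  intro k μ
  simp only [Pi.smul_apply, smul_eq_mul, h k μ, map_mul, Finset.mul_sum]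
  exact Finset.sum_congr rfl fun _ _ => by ring

theorem IsLorentzTransform.smul_algebraMap (h : IsLorentzTransform L T K) (c : ℝ) :
    IsLorentzTransform L (algebraMap ℝ (Poly d) c • T) (algebraMap ℝ (Poly d) c • K) := by
  simpa only [AlgHom.commutes] using h.smul (algebraMap ℝ (Poly d) c)

theorem IsLorentzTransform.X_smul (hL : IsLorentz L) (h : IsLorentzTransform L T K) (i : Fin d) :
    IsLorentzTransform L (∑ j, algebraMap ℝ (Poly d) (L i j) • (MvPolynomial.X j : Poly d) • T)
      ((MvPolynomial.X i : Poly d) • K) := by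
  have := h.smul (∑ j, algebraMap ℝ (Poly d) (L i j) • MvPolynomial.X j)
  rw [lorentzSubst_sum_X hL, Finset.sum_smul] at this
  simpa only [smul_assoc] using this

theorem IsLorentzTransform.sum {ι : Type*} (u : Finset ι) {F G : ι → Multiset (Fin d) → Poly d}
    (h : ∀ i ∈ u, IsLorentzTransform L (F i) (G i)) :
    IsLorentzTransform L (∑ i ∈ u, F i) (∑ i ∈ u, G i) := by
  refine isLorentzTransform_iff.2 fun k μ => ?_
  simp only [Finset.sum_apply, map_sum, Finset.mul_sum]
  rw [Finset.sum_comm]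
  exact Finset.sum_congr rfl fun i hi => isLorentzTransform_iff.1 (h i hi) k μ

theorem IsLorentzTransform.contract (h : IsLorentzTransform L T K) (i : Fin d) :
    IsLorentzTransform L
      (∑ j, algebraMap ℝ (Poly d) (L i j) • MassiveSpin.contract (R := Poly d) j T)
      (MassiveSpin.contract (R := Poly d) i K) := by
  refine isLorentzTransform_iff.2 fun k μ => ?_
  change K (i ::ₘ _) = _
  rw [← coe_ofFn_insertNth 0 i μ, isLorentzTransform_iff.1 h, sum_insertNth 0]
  refine Finset.sum_congr rfl fun ν _ => ?_
  rw [Finset.sum_apply, map_sum, Finset.mul_sum]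
  refine Finset.sum_congr rfl fun j _ => ?_
  rw [Fin.prod_univ_succAbove _ 0, coe_ofFn_insertNth, Pi.smul_apply, smul_eq_mul, map_mul,
    AlgHom.commutes]
  simp only [Fin.insertNth_apply_same, Fin.insertNth_apply_succAbove]
  change _ * lorentzSubst L (T _) = _ * (_ * lorentzSubst L (T _))
  ring

/-- The label of the inserted basis covector transforms with `L⁻¹`: at each position the sum over
the inserted index is an entry of `L L⁻¹ = 1`. -/
theorem IsLorentzTransform.insertIdx (hL : IsLorentz L) (h : IsLorentzTransform L T K)
    (i : Fin d) :
    IsLorentzTransform L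
      (∑ j, algebraMap ℝ (Poly d) (L⁻¹ j i) • MassiveSpin.insertIdx (R := Poly d) j T)
      (MassiveSpin.insertIdx (R := Poly d) i K) := by
  refine isLorentzTransform_iff.2 fun k μ => ?_
  cases k with
  | zero =>
    rw [insertIdx_ofFn_zero, eq_comm]
    refine Finset.sum_eq_zero fun ν _ => ?_
    simp only [Finset.sum_apply, Pi.smul_apply, insertIdx_ofFn_zero, smul_zero,
      Finset.sum_const_zero, map_zero, mul_zero]
  | succ k =>
    have hinv : ∀ a, ∑ j, algebraMap ℝ (Poly d) (L (μ a) j) * algebraMap ℝ (Poly d) (L⁻¹ j i)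
        = if μ a = i then 1 else 0 := by
      intro a
      have := congrFun (congrFun hL.mul_inv (μ a)) i
      rw [Matrix.mul_apply, Matrix.one_apply] at this
      simp only [← map_mul]
      rw [← map_sum, this]
      split_ifs <;> simp
    have hT : ∀ ν : Fin (k + 1) → Fin d, lorentzSubst L
        ((∑ j, algebraMap ℝ (Poly d) (L⁻¹ j i) • MassiveSpin.insertIdx (R := Poly d) j T)
          (List.ofFn ν : Multiset (Fin d)))
        = ∑ a, algebraMap ℝ (Poly d) (L⁻¹ (ν a) i) *
          lorentzSubst L (T (List.ofFn (a.removeNth ν) : Multiset (Fin d))) := by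
      intro ν
      simp only [Finset.sum_apply, Pi.smul_apply, insertIdx_ofFn, smul_eq_mul, Finset.mul_sum]
      rw [Finset.sum_comm, map_sum]
      refine Finset.sum_congr rfl fun a _ => ?_
      simp
    rw [insertIdx_ofFn]
    simp only [hT, Finset.mul_sum]
    rw [Finset.sum_comm]
    refine Finset.sum_congr rfl fun a _ => ?_
    rw [sum_insertNth a]
    have e : ∀ ν : Fin k → Fin d, ∑ j : Fin d,
        (∏ b, algebraMap ℝ (Poly d) (L (μ b) ((a.insertNth j ν : Fin (k + 1) → Fin d) b))) *
          (algebraMap ℝ (Poly d) (L⁻¹ ((a.insertNth j ν : Fin (k + 1) → Fin d) a) i) *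
            lorentzSubst L (T (List.ofFn (a.removeNth (a.insertNth j ν : Fin (k + 1) → Fin d)) :
              Multiset (Fin d))))
        = (if μ a = i then 1 else 0) *
          ((∏ b, algebraMap ℝ (Poly d) (L (a.removeNth μ b) (ν b))) *
            lorentzSubst L (T (List.ofFn ν : Multiset (Fin d)))) := by
      intro ν
      rw [← hinv a, Finset.sum_mul]
      refine Finset.sum_congr rfl fun j _ => ?_
      rw [Fin.prod_univ_succAbove _ a]
      simp only [Fin.insertNth_apply_same, Fin.insertNth_apply_succAbove, Fin.removeNth_insertNth,
        Fin.removeNth_apply]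
      ring
    rw [Finset.sum_congr rfl fun ν _ => e ν, ← Finset.mul_sum, ← isLorentzTransform_iff.1 h]
    split_ifs <;> simp

theorem IsLorentzTransform.trace (hL : IsLorentz L) (h : IsLorentzTransform L T K) :
    IsLorentzTransform L (MassiveSpin.trace (R := Poly d) T)
      (MassiveSpin.trace (R := Poly d) K) := by
  rw [trace_apply, trace_apply, ← sum_smul_sum_smul hL.sum_eta fun l j =>
    MassiveSpin.contract (R := Poly d) l (MassiveSpin.contract (R := Poly d) j T)]
  refine IsLorentzTransform.sum _ fun i _ => IsLorentzTransform.smul_algebraMap ?_ _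
  have := (h.contract i).contract i
  simpa only [map_sum, map_smul, Finset.smul_sum] using this

theorem IsLorentzTransform.metricMul (hL : IsLorentz L) (h : IsLorentzTransform L T K) :
    IsLorentzTransform L (MassiveSpin.metricMul (R := Poly d) T)
      (MassiveSpin.metricMul (R := Poly d) K) := by
  rw [metricMul_apply, metricMul_apply]
  refine IsLorentzTransform.smul_algebraMap ?_ _
  rw [← sum_smul_sum_smul (A := fun i l => L⁻¹ l i) (B := fun i l => L⁻¹ l i) hL.sum_eta_inv
    fun l j => MassiveSpin.insertIdx (R := Poly d) l (MassiveSpin.insertIdx (R := Poly d) j T)]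
  refine IsLorentzTransform.sum _ fun i _ => IsLorentzTransform.smul_algebraMap ?_ _
  have := IsLorentzTransform.insertIdx hL (IsLorentzTransform.insertIdx hL h i) i
  simpa only [map_sum, map_smul, Finset.smul_sum] using this

theorem IsLorentzTransform.divergence (hL : IsLorentz L) (h : IsLorentzTransform L T K) :
    IsLorentzTransform L (MassiveSpin.divergence momentum T)
      (MassiveSpin.divergence momentum K) := by
  simp only [divergence_apply, momentum_compLeft]
  rw [← sum_smul_sum_smul hL.sum_eta fun l j =>
    (MvPolynomial.X l : Poly d) • MassiveSpin.contract (R := Poly d) j T]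
  refine IsLorentzTransform.sum _ fun i _ => IsLorentzTransform.smul_algebraMap ?_ _
  have := IsLorentzTransform.X_smul hL (h.contract i) i
  simpa only [Finset.smul_sum, smul_comm (MvPolynomial.X _ : Poly d)] using this

theorem IsLorentzTransform.gradient (hL : IsLorentz L) (h : IsLorentzTransform L T K) :
    IsLorentzTransform L (MassiveSpin.gradient momentum T)
      (MassiveSpin.gradient momentum K) := by
  have e := sum_smul_sum_smul (P := Poly d) (w := fun _ => 1) (w' := fun _ => 1) (A := L)
    (B := fun i l => L⁻¹ l i) hL.sum_inv
    fun l j => (MvPolynomial.X l : Poly d) • MassiveSpin.insertIdx (R := Poly d) j T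
  simp only [map_one, one_smul] at e
  simp only [gradient_apply, momentum_compLeft]
  rw [← e]
  refine IsLorentzTransform.sum _ fun i _ => ?_
  have := IsLorentzTransform.X_smul hL (IsLorentzTransform.insertIdx hL h i) i
  simpa only [Finset.smul_sum, smul_comm (MvPolynomial.X _ : Poly d)] using this

theorem IsLorentzTransform.pow {F : Module.End (Poly d) (Multiset (Fin d) → Poly d)}
    (hF : ∀ {T K}, IsLorentzTransform L T K → IsLorentzTransform L (F T) (F K))
    (h : IsLorentzTransform L T K) (n : ℕ) : IsLorentzTransform L ((F ^ n) T) ((F ^ n) K) := by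
  induction n with
  | zero => exact h
  | succ n ih =>
    rw [pow_succ', Module.End.mul_apply, Module.End.mul_apply]
    exact hF ih

theorem IsLorentzTransform.tracelessPart (hL : IsLorentz L) (h : IsLorentzTransform L T K)
    (k : ℕ) : IsLorentzTransform L (MassiveSpin.tracelessPart (R := Poly d) k T)
      (MassiveSpin.tracelessPart (R := Poly d) k K) := by
  simp only [MassiveSpin.tracelessPart, LinearMap.sum_apply, LinearMap.smul_apply,
    Module.End.mul_apply]
  exact IsLorentzTransform.sum _ fun j _ => IsLorentzTransform.smul_algebraMap
    ((h.pow (IsLorentzTransform.trace hL) j).pow (IsLorentzTransform.metricMul hL) j) _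

theorem IsLorentzTransform.gradDiv (hL : IsLorentz L) {k t n l : ℕ} (hk : k - l + n = t)
    {S S' : polyST d k} (h : IsLorentzTransform L S.1 S'.1) :
    IsLorentzTransform L (MassiveSpin.gradDiv momentum k t n l hk S).1
      (MassiveSpin.gradDiv momentum k t n l hk S').1 :=
  (IsLorentzTransform.tracelessPart hL ((h.pow (IsLorentzTransform.divergence hL) l).pow
    (IsLorentzTransform.gradient hL) n) t).smul_algebraMap _

theorem isLorentzTransform_symbolX {s : ℕ} {m : ℝ} (hL : IsLorentz L)
    {J K : polyST d s × polyST d (s - 1)} (h₁ : IsLorentzTransform L J.1.1 K.1.1)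
    (h₂ : IsLorentzTransform L J.2.1 K.2.1) :
    IsLorentzTransform L (symbolX d s m J).1 (symbolX d s m K).1 := by
  rw [symbolX_coe, symbolX_coe, auxOp₂_coe', auxOp₂_coe']
  exact (IsLorentzTransform.sum _ fun l _ => (h₁.gradDiv hL _).smul_algebraMap _).add
    (IsLorentzTransform.sum _ fun l _ => (h₂.gradDiv hL _).smul_algebraMap _)

end Lorentz

end MassiveSpin

open MassiveSpin in
theorem mainTheorem3 (d s : ℕ) (hd : 2 ≤ d) (hs : 1 ≤ s) (m : ℝ) (hm : m ≠ 0) :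
    -- `A` and `A_1` are the symbols of the wave operator and of the compatibility operator
    (∀ (J : polyST d s × polyST d (s - 1)) (φ : polyST d s),
      contraction s (symbolA d s m hs J).1 φ.1 = contractionPair J (waveOp momentum m s φ)) ∧
    (∀ (Y : polyST d (s - 1)) (J : polyST d s × polyST d (s - 1)),
      contractionPair (symbolA₁ d s m hs Y) J = contraction (s - 1) Y.1 (compatOp momentum m s J).1) ∧
    -- `A_1` is the unimodular compatibility symbol of `A`, so `A` is co-flat
    IsOneStepResolution (symbolA₁ d s m hs) (symbolA d s m hs) ∧
    IsUnimodular (symbolA₁ d s m hs) ∧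
    IsCoFlat (symbolA d s m hs) ∧
    -- the explicit Lorentz-invariant left inverse `X` of `A_1`, and `A ∼ (X; A)`
    (∃ X : polyST d s × polyST d (s - 1) →ₗ[Poly d] polyST d (s - 1),
      (∀ (J : polyST d s × polyST d (s - 1)) (ψ : polyST d (s - 1)),
        contraction (s - 1) (X J).1 ψ.1 = contractionPair J (auxOp momentum m s ψ)) ∧
      X ∘ₗ symbolA₁ d s m hs = LinearMap.id ∧
      (∀ L : Matrix (Fin d) (Fin d) ℝ, IsLorentz L →
        ∀ J K : polyST d s × polyST d (s - 1),
          IsLorentzTransform L J.1.1 K.1.1 → IsLorentzTransform L J.2.1 K.2.1 →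
          IsLorentzTransform L (X J).1 (X K).1) ∧
      LinearMap.ker (X.prod (symbolA d s m hs)) = ⊥ ∧
      Nonempty ((polyST d s ⧸ LinearMap.range (symbolA d s m hs)) ≃ₗ[Poly d]
        ((polyST d (s - 1) × polyST d s) ⧸ LinearMap.range (X.prod (symbolA d s m hs))))) ∧
    -- the extended system is equivalent to the original one on every open domain
    (∀ Ω : TopologicalSpace.Opens (Fin d → ℝ),
      compatOp (partialDeriv Ω) m s ∘ₗ auxOp (partialDeriv Ω) m s = LinearMap.id ∧
      ∀ (φ : stTensor d ℝ (smoothFn Ω) s) (ψ : stTensor d ℝ (smoothFn Ω) (s - 1)),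
        extendedOp (partialDeriv Ω) m s (φ, ψ) = 0 ↔ waveOp (partialDeriv Ω) m s φ = 0 ∧ ψ = 0) := by
  refine ⟨contraction_symbolA m hs, contractionPair_symbolA₁ m hs,
    isOneStepResolution_symbolA hd hm hs, Or.inl ⟨symbolX d s m, symbolX_comp_symbolA₁ hd hm hs⟩,
    isCoFlat_symbolA hd hm hs, ⟨symbolX d s m, contraction_symbolX m,
      symbolX_comp_symbolA₁ hd hm hs, fun L hL J K h₁ h₂ => isLorentzTransform_symbolX hL h₁ h₂,
      ker_prod_eq_bot (symbolX_comp_symbolA₁ hd hm hs) (exact_symbolA₁_symbolA hd hm hs),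
      nonempty_coker_prod_equiv (symbolX_comp_symbolA₁ hd hm hs)
        (exact_symbolA₁_symbolA hd hm hs)⟩,
    fun Ω => ⟨compatOp_comp_auxOp hd (partialDeriv_commute Ω) hm hs,
      extendedOp_eq_zero_iff hd (partialDeriv_commute Ω) hm hs⟩⟩
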